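/- Let $\mathbb K$ be $\mathbb R$ or $\mathbb C$; all Banach spaces are over $\mathbb K$ and operators are bounded and linear. \textbf{Szlenk index.} For a Banach space $X$, $\epsilon>0$ and $K\subseteq X^*$ put $s_\epsilon(K)=\{x^*\in K : \operatorname{diam}_{\|\cdot\|}(\mathcal U\cap K)>\epsilon \text{ for every weak}^*\text{-open } \mathcal U\ni x^*\}$, and let $s_\epsilon^0(K)=K$, $s_\epsilon^{\xi+1}(K)=s_\epsilon(s_\epsilon^\xi(K))$, $s_\epsilon^\xi(K)=\bigcap_{\zeta<\xi}s_\epsilon^\zeta(K)$ for limit $\xi$. Let $Sz(K,\epsilon)$ be the least ordinal $\xi$ with $s^\xi_\epsilon(K)=\emptyset$ if there is one, and $\infty$ otherwise, and $Sz(K)=\sup_{\epsilon>0}Sz(K,\epsilon)$. For an operator $T:X\to Y$ put $Sz(T)=Sz(T^*(B_{Y^*}))$. $T$ is $\alpha$-Szlenk if $Sz(T)\le\omega^\alpha$, and non-$\alpha$-Szlenk otherwise (i.e. $Sz(T)$ is $\infty$ or exceeds $\omega^\alpha$). An operator $S:W\to Z$ factors through $T:X\to Y$ if there are operators $U:W\to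 X$ and $V:Y\to Z$ with $VTU=S$. An operator is universal for a class of operators if it belongs to the class and factors through every member of the class. \textbf{Trees.} A tree is a partially ordered set $(\mathcal T,\preceq)$ such that $\{s : s\preceq t\}$ is well-ordered for each $t$. It is rooted if it has at most one minimal element, and well-founded if it has no infinite branch (maximal chain). Put $\mathcal T^{(0)}=\mathcal T$, let $\mathcal T^{(\xi+1)}$ be $\mathcal T^{(\xi)}$ without its maximal elements, and $\mathcal T^{(\xi)}=\bigcap_{\zeta<\xi}\mathcal T^{(\zeta)}$ for limit $\xi$. For well-founded $\mathcal T$, $\rho(\mathcal T)=\min\{\xi : \mathcal T^{(\xi)}=\emptyset\}$, and $\rho_{\mathcal T}(t)$ is the unique $\xi$ with $t\in\mathcal T^{(\xi)}\setminus\mathcal T^{(\xi+1)}$. A countable, rooted, well-founded tree is blossomed if for each non-maximal $t$ there is a bijection $\psi$ from $\omega$ onto the set of immediate successors of $t$ such that $\rho_{\mathcal T}(\psi(m))\le\rho_{\mathcal T}(\psi(n))$ whenever $m\le n$. The coarse wedge topology of $\mathcal T$ has as a subbase the sets $\mathcal T[t\preceq]=\{s : t\preceq s\}$ and their complements, for those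 $t$ such that the order type of $\{s: s\prec t\}$ is $0$ or a successor; it is compact if $\mathcal T$ is rooted and well-founded. For nonempty, rooted, well-founded $\mathcal T$ let $C_0(\mathcal T)$ be the Banach space, with the supremum norm, of the coarse-wedge-continuous functions $\mathcal T\to\mathbb K$ vanishing at the root, let $\mathcal T^\star$ be $\mathcal T$ without its root, and let $\mathring\sigma_{\mathcal T}:\ell_1(\mathcal T^\star)\to C_0(\mathcal T)$ be the unique operator with $\mathring\sigma_{\mathcal T}e_t=\chi_{\mathcal T[t\preceq]}$ for every $t\in\mathcal T^\star$. \textbf{Theorem.} Let $\alpha<\omega_1$ and let $\mathcal T$ be a countably infinite, rooted, well-founded tree with $\rho(\mathcal T)<\omega^{\alpha+1}$. (1) If $X$ and $Y$ are Banach spaces, $Y$ is separable and $T:X\to Y$ is a non-$\alpha$-Szlenk operator, then $\mathring\sigma_{\mathcal T}$ factors through $T$. (2) If moreover $\mathcal T$ is blossomed and $\rho(\mathcal T)\ge\omega^\alpha$, then $\mathring\sigma_{\mathcal T}$ is universal for the class of non-$\alpha$-Szlenk operators (between Banach spaces) with separable codomain. -/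

import Mathlib

open scoped Ordinal ENNReal

universe u v v' w

noncomputable section

namespace SzlenkTree

/-! ### The Szlenk index -/

section Szlenk

variable {𝕜 : Type w} [RCLike 𝕜] {X : Type u} [NormedAddCommGroup X] [NormedSpace 𝕜 X]

/-- The derivation `s_ε`: all points of `K` each of whose weak-star neighbourhoods meets `K` in a
set of norm diameter greater than `ε`. -/
def szlenkDeriv (ε : ℝ) (K : Set (StrongDual 𝕜 X)) : Set (StrongDual 𝕜 X) :=
  {x | x ∈ K ∧ ∀ U : Set (WeakDual 𝕜 X), IsOpen U → StrongDual.toWeakDual x ∈ U →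
    ENNReal.ofReal ε < Metric.ediam (StrongDual.toWeakDual ⁻¹' U ∩ K)}

/-- The transfinite iterates `s_ε^ξ(K)`. -/
def szlenkIter (ε : ℝ) (K : Set (StrongDual 𝕜 X)) (ξ : Ordinal.{v}) : Set (StrongDual 𝕜 X) :=
  Ordinal.limitRecOn ξ K (fun _ S => szlenkDeriv ε S) (fun o _ S => ⋂ (ζ) (h : ζ < o), S ζ h)

/-- `Sz(K, ε)`: the least `ξ` with `s_ε^ξ(K) = ∅`, and `⊤` if there is no such ordinal. -/
def szlenkIndexEps (K : Set (StrongDual 𝕜 X)) (ε : ℝ) : WithTop Ordinal.{u} :=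
  sInf {i | ∃ ξ : Ordinal.{u}, i = ξ ∧ szlenkIter ε K ξ = ∅}

/-- `Sz(K)`: the supremum of the `Sz(K, ε)` over `ε > 0`; it is `⊤` (undefined) as soon as one of
them is. -/
def szlenkIndex (K : Set (StrongDual 𝕜 X)) : WithTop Ordinal.{u} :=
  ⨆ (ε : ℝ) (_ : 0 < ε), szlenkIndexEps K ε

variable {Y : Type v} [NormedAddCommGroup Y] [NormedSpace 𝕜 Y]

/-- `T^*(B_{Y^*})`, the image of the closed dual unit ball under the adjoint of `T`. -/
def adjointBall (T : X →L[𝕜] Y) : Set (StrongDual 𝕜 X) :=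
  (fun g : StrongDual 𝕜 Y => g.comp T) '' Metric.closedBall 0 1

/-- `T` is `α`-Szlenk: `Sz(T)` is defined and at most `ω ^ α`. -/
def IsSzlenk (α : Ordinal.{u}) (T : X →L[𝕜] Y) : Prop :=
  szlenkIndex (adjointBall T) ≤ ((ω ^ α : Ordinal.{u}) : WithTop Ordinal.{u})

end Szlenk

/-! ### Factorization and universality -/

section Factor

variable {𝕜 : Type*} [RCLike 𝕜]
  {W : Type*} [NormedAddCommGroup W] [NormedSpace 𝕜 W]
  {Z : Type*} [NormedAddCommGroup Z] [NormedSpace 𝕜 Z]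
  {X : Type*} [NormedAddCommGroup X] [NormedSpace 𝕜 X]
  {Y : Type*} [NormedAddCommGroup Y] [NormedSpace 𝕜 Y]

/-- `S` factors through `T`. -/
def FactorsThrough (S : W →L[𝕜] Z) (T : X →L[𝕜] Y) : Prop :=
  ∃ (U : W →L[𝕜] X) (V : Y →L[𝕜] Z), V ∘L T ∘L U = S

end Factor

/-- Membership in the class of non-`α`-Szlenk operators between Banach spaces whose codomain is
separable, for `α` an ordinal of the lowest universe (which contains all countable ordinals). -/
def IsNonSzlenkSep {𝕜 : Type w} [RCLike 𝕜]
    {X : Type u} [NormedAddCommGroup X] [NormedSpace 𝕜 X] [CompleteSpace X]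
    {Y : Type v} [NormedAddCommGroup Y] [NormedSpace 𝕜 Y] [CompleteSpace Y]
    (α : Ordinal.{0}) (T : X →L[𝕜] Y) : Prop :=
  ¬ IsSzlenk (Ordinal.lift.{u} α) T ∧ TopologicalSpace.SeparableSpace Y

/-- `S` is universal for the class of non-`α`-Szlenk operators with separable codomain: it belongs
to the class and factors through every member of it (with spaces in the universes `u`, `v`). -/
def IsUniversalNonSzlenkSep {𝕜 : Type w} [RCLike 𝕜]
    {W : Type*} [NormedAddCommGroup W] [NormedSpace 𝕜 W] [CompleteSpace W]
    {Z : Type*} [NormedAddCommGroup Z] [NormedSpace 𝕜 Z] [CompleteSpace Z]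
    (α : Ordinal.{0}) (S : W →L[𝕜] Z) : Prop :=
  IsNonSzlenkSep α S ∧
    ∀ (X : Type u) [NormedAddCommGroup X] [NormedSpace 𝕜 X] [CompleteSpace X]
      (Y : Type v) [NormedAddCommGroup Y] [NormedSpace 𝕜 Y] [CompleteSpace Y]
      (T : X →L[𝕜] Y), IsNonSzlenkSep α T → FactorsThrough S T

/-! ### Trees -/

/-- A tree: a partial order in which every `{s | s ≤ t}` is well-ordered. -/
class IsTree (T : Type u) [PartialOrder T] : Prop where
  isWellOrder_Iic : ∀ t : T, IsWellOrder (Set.Iic t) (· < ·)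

/-- Rooted: there is at most one minimal node. -/
class IsRooted (T : Type u) [PartialOrder T] : Prop where
  subsingleton_min : {t : T | IsMin t}.Subsingleton

/-- Well-founded: there is no infinite branch (a branch is a maximal chain). -/
class IsWellFoundedTree (T : Type u) [PartialOrder T] : Prop where
  finite_branch : ∀ B : Set T, IsMaxChain (· ≤ ·) B → B.Finite

section Rank

variable (T : Type u) [PartialOrder T]

/-- The derived trees: remove the maximal nodes at successor stages, intersect at limits. -/
def derivedTree (ξ : Ordinal.{u}) : Set T :=
  Ordinal.limitRecOn ξ Set.univ (fun _ S => S \ {t | Maximal (· ∈ S) t})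
    (fun o _ S => ⋂ (ζ) (h : ζ < o), S ζ h)

/-- The rank of a (well-founded) tree: the least `ξ` such that the `ξ`-th derived tree is empty. -/
def treeRank : Ordinal.{u} := sInf {ξ | derivedTree T ξ = ∅}

variable {T}

/-- The rank of a node (of a well-founded tree): the unique `ξ` for which the node belongs to the
`ξ`-th derived tree and not to the next one. -/
def nodeRank (t : T) : Ordinal.{u} :=
  sInf {ξ | t ∈ derivedTree T ξ \ derivedTree T (ξ + 1)}

/-- The immediate successors of `t`. -/
def immSucc (t : T) : Set T := {s | Minimal (fun r => t < r) s}

variable (T)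

/-- Blossomed trees. -/
def IsBlossomed : Prop :=
  IsTree T ∧ Countable T ∧ IsRooted T ∧ IsWellFoundedTree T ∧
    ∀ t : T, ¬ IsMax t → ∃ ψ : ℕ ≃ immSucc t,
      ∀ m n : ℕ, m ≤ n → nodeRank (ψ m : T) ≤ nodeRank (ψ n : T)

/-- The tree without its minimal nodes, i.e. without its root. -/
def starTree : Set T := {t | ¬ IsMin t}

end Rank

/-! ### The coarse wedge topology -/

/-- A copy of the tree `T`, to carry the coarse wedge topology. -/
def CoarseWedge (T : Type u) : Type u := T

instance CoarseWedge.partialOrder (T : Type u) [PartialOrder T] : PartialOrder (CoarseWedge T) :=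
  inferInstanceAs (PartialOrder T)

/-- The identity map of `T` onto its copy. -/
def CoarseWedge.of {T : Type u} [PartialOrder T] : T ≃o CoarseWedge T := OrderIso.refl T

instance CoarseWedge.isTree (T : Type u) [PartialOrder T] [h : IsTree T] :
    IsTree (CoarseWedge T) := h

instance CoarseWedge.isRooted (T : Type u) [PartialOrder T] [h : IsRooted T] :
    IsRooted (CoarseWedge T) := h

instance CoarseWedge.isWellFoundedTree (T : Type u) [PartialOrder T] [h : IsWellFoundedTree T] :
    IsWellFoundedTree (CoarseWedge T) := h

/-- The coarse wedge topology: a subbase consists of the sets `{s | t ≤ s}` and their complements,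
for those `t` for which the order type of `{s | s < t}` is `0` (no element) or a successor (there
is a greatest element). -/
instance coarseWedgeTopology (T : Type u) [PartialOrder T] : TopologicalSpace (CoarseWedge T) :=
  TopologicalSpace.generateFrom
    {U | ∃ t : CoarseWedge T, (Set.Iio t = ∅ ∨ ∃ s, IsGreatest (Set.Iio t) s) ∧
      (U = Set.Ici t ∨ U = (Set.Ici t)ᶜ)}

section WellFounded

variable {T : Type u} [PartialOrder T]

theorem finite_of_isChain [IsWellFoundedTree T] {C : Set T} (hC : IsChain (· ≤ ·) C) :
    C.Finite := by
  obtain ⟨M, hM, hCM⟩ := hC.exists_maxChain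
  exact (IsWellFoundedTree.finite_branch M hM).subset hCM

theorem le_total_of_le [IsTree T] {s t r : T} (hs : s ≤ r) (ht : t ≤ r) : s ≤ t ∨ t ≤ s := by
  have := IsTree.isWellOrder_Iic r
  by_contra! h
  have h1 := Std.Trichotomous.trichotomous (r := ((· < ·) : Set.Iic r → Set.Iic r → Prop))
    ⟨s, hs⟩ ⟨t, ht⟩ (fun h' => h.1 (le_of_lt h')) (fun h' => h.2 (le_of_lt h'))
  exact h.1 (le_of_eq (congrArg Subtype.val h1))

theorem isChain_Iic [IsTree T] (r : T) : IsChain (· ≤ ·) (Set.Iic r) :=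
  fun _ hs _ ht _ => le_total_of_le hs ht

theorem exists_isGreatest_of_isChain [IsWellFoundedTree T] {C : Set T}
    (hC : IsChain (· ≤ ·) C) (hne : C.Nonempty) : ∃ t, IsGreatest C t := by
  obtain ⟨t, ht⟩ := (finite_of_isChain hC).exists_maximal hne
  refine ⟨t, ht.prop, fun s hs => ?_⟩
  rcases hC.total hs ht.prop with h | h
  · exact h
  · exact ht.le_of_ge hs h

theorem isClopen_Ici [IsTree T] [IsWellFoundedTree T] (t : CoarseWedge T) :
    IsClopen (Set.Ici t) := by
  have key : Set.Iio t = ∅ ∨ ∃ s, IsGreatest (Set.Iio t) s := by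
    rcases (Set.Iio t).eq_empty_or_nonempty with h | h
    · exact Or.inl h
    · exact Or.inr (exists_isGreatest_of_isChain
        ((isChain_Iic t).mono fun s hs => le_of_lt hs) h)
  refine ⟨⟨?_⟩, ?_⟩
  · exact TopologicalSpace.isOpen_generateFrom_of_mem ⟨t, key, Or.inr rfl⟩
  · exact TopologicalSpace.isOpen_generateFrom_of_mem ⟨t, key, Or.inl rfl⟩

/-- The coarse wedge topology of a rooted, well-founded tree is compact. -/
instance compactSpace_coarseWedge [IsTree T] [IsRooted T] [IsWellFoundedTree T] :
    CompactSpace (CoarseWedge T) := by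
  refine ⟨isCompact_iff_ultrafilter_le_nhds.2 fun f _ => ?_⟩
  have hmin : ∀ r : CoarseWedge T, ∃ m, IsMin m ∧ m ≤ r := fun r => by
    obtain ⟨m, hm⟩ := (finite_of_isChain (isChain_Iic r)).exists_minimal ⟨r, le_refl r⟩
    exact ⟨m, fun s hs => hm.le_of_le (le_trans hs hm.prop) hs, hm.prop⟩
  have hchain : IsChain (· ≤ ·) {t : CoarseWedge T | Set.Ici t ∈ f} := by
    intro s hs t ht _
    obtain ⟨r, hr⟩ := f.nonempty_of_mem (Filter.inter_mem hs ht)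
    exact le_total_of_le hr.1 hr.2
  have hne : {t : CoarseWedge T | Set.Ici t ∈ f}.Nonempty := by
    obtain ⟨r, -⟩ := f.nonempty_of_mem (Filter.univ_mem)
    obtain ⟨m, hm, -⟩ := hmin r
    refine ⟨m, Filter.mem_of_superset Filter.univ_mem fun s _ => ?_⟩
    obtain ⟨m', hm', hs⟩ := hmin s
    rw [IsRooted.subsingleton_min hm hm']
    exact hs
  obtain ⟨t, ht, hmax⟩ := exists_isGreatest_of_isChain hchain hne
  refine ⟨t, Set.mem_univ _, ?_⟩
  rw [TopologicalSpace.nhds_generateFrom]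
  refine le_iInf₂ fun U hU => ?_
  obtain ⟨htU, s, -, rfl | rfl⟩ := hU
  · exact Filter.le_principal_iff.2 (Filter.mem_of_superset ht (Set.Ici_subset_Ici.2 htU))
  · refine Filter.le_principal_iff.2 (Ultrafilter.compl_mem_iff_notMem.2 fun hs => htU ?_)
    exact hmax hs

end WellFounded

/-! ### The operator on `ℓ₁` -/

theorem summable_norm_ellOne {𝕜 : Type w} [RCLike 𝕜] {ι : Type u} (x : lp (fun _ : ι => 𝕜) 1) :
    Summable fun t => ‖x t‖ := by
  simpa using (lp.memℓp x).summable (by simp)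

section Operator

variable (𝕜 : Type w) [RCLike 𝕜] (T : Type u) [PartialOrder T] [IsTree T] [IsRooted T]
  [IsWellFoundedTree T]

/-- `C₀(T)`: the coarse-wedge-continuous scalar functions on `T`, with the supremum norm, that
vanish at the root. -/
def C0 : Submodule 𝕜 C(CoarseWedge T, 𝕜) where
  carrier := {f | ∀ t : CoarseWedge T, IsMin t → f t = 0}
  add_mem' := fun hf hg t ht => by
    rw [ContinuousMap.add_apply, hf t ht, hg t ht, add_zero]
  zero_mem' := fun _ _ => rfl
  smul_mem' := fun c f hf t ht => by
    rw [ContinuousMap.smul_apply, hf t ht, smul_zero]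

instance completeSpace_C0 : CompleteSpace (C0 𝕜 T) := by
  have h : IsClosed ((C0 𝕜 T : Set C(CoarseWedge T, 𝕜))) := by
    have : (C0 𝕜 T : Set C(CoarseWedge T, 𝕜)) =
        ⋂ (t : CoarseWedge T) (_ : IsMin t), {f : C(CoarseWedge T, 𝕜) | f t = 0} := by
      ext f
      simp only [Set.mem_iInter]
      exact Iff.rfl
    rw [this]
    exact isClosed_iInter fun t => isClosed_iInter fun _ =>
      isClosed_eq (ContinuousEvalConst.continuous_eval_const _) continuous_const
  exact h.completeSpace_coe

variable {T}

/-- The indicator function of `{s | t ≤ s}`, for `t` a node other than the root. -/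
def wedgeIndicator (t : starTree T) : C0 𝕜 T :=
  ⟨⟨Set.indicator (Set.Ici (CoarseWedge.of (t : T))) fun _ => (1 : 𝕜),
    (isClopen_Ici (CoarseWedge.of (t : T))).continuous_indicator continuous_const⟩,
    fun _ hs => Set.indicator_of_notMem (s := Set.Ici (CoarseWedge.of (t : T)))
      (f := fun _ => (1 : 𝕜)) (fun hts => t.2 fun _ hr => IsMin.mono hs hts hr)⟩

theorem norm_wedgeIndicator_le (t : starTree T) : ‖wedgeIndicator 𝕜 t‖ ≤ 1 := by
  refine (ContinuousMap.norm_le _ zero_le_one).2 fun s => ?_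
  exact (norm_indicator_le_norm_self
    (s := Set.Ici (CoarseWedge.of (t : T))) (fun _ => (1 : 𝕜)) s).trans norm_one.le

variable (T)

/-- `ℓ₁` over the tree without its root. -/
abbrev EllOneStar : Type (max u w) := lp (fun _ : starTree T => 𝕜) 1

variable {𝕜 T}

theorem summable_smul_wedge (x : EllOneStar 𝕜 T) :
    Summable fun t => x t • wedgeIndicator 𝕜 t := by
  refine Summable.of_norm_bounded (summable_norm_ellOne x) fun t => ?_
  rw [norm_smul]
  exact mul_le_of_le_one_right (norm_nonneg _) (norm_wedgeIndicator_le 𝕜 t)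

variable (𝕜 T)

/-- The operator from `ℓ₁` over the tree without its root to `C₀(T)` that sends each unit vector
`e_t` to the indicator function of `{s | t ≤ s}`. -/
def sigmaOp : EllOneStar 𝕜 T →L[𝕜] C0 𝕜 T :=
  LinearMap.mkContinuous
    { toFun := fun x => ∑' t, x t • wedgeIndicator 𝕜 t
      map_add' := fun x y => by
        rw [← (summable_smul_wedge x).tsum_add (summable_smul_wedge y)]
        exact tsum_congr fun t => by rw [lp.coeFn_add, Pi.add_apply, add_smul]
      map_smul' := fun c x => by
        rw [RingHom.id_apply, ← (summable_smul_wedge x).tsum_const_smul c]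
        exact tsum_congr fun t => by
          rw [lp.coeFn_smul, Pi.smul_apply, smul_eq_mul, mul_smul] }
    1 fun x => by
      have hx : ‖x‖ = ∑' t, ‖x t‖ := by
        simpa using lp.norm_eq_tsum_rpow (by simp) x
      rw [one_mul, hx]
      refine tsum_of_norm_bounded (summable_norm_ellOne x).hasSum fun t => ?_
      rw [norm_smul]
      exact mul_le_of_le_one_right (norm_nonneg _) (norm_wedgeIndicator_le 𝕜 t)

open Classical in
/-- `sigmaOp` sends unit vectors to indicator functions. -/
theorem sigmaOp_single (t : starTree T) :
    sigmaOp 𝕜 T (lp.single 1 t 1) = wedgeIndicator 𝕜 t := by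
  change ∑' s, (lp.single 1 t (1 : 𝕜) : EllOneStar 𝕜 T) s • wedgeIndicator 𝕜 s = _
  rw [tsum_eq_single t fun s hs => by rw [lp.single_apply_ne _ _ _ hs, zero_smul],
    lp.single_apply_self, one_smul]

end Operator

end SzlenkTree

end

/-!
The factorization rests on the following criterion. For a node `t` other than the root let `t⁻` be
its immediate predecessor. Suppose functionals `y t` in the dual ball of `Y`, zero at the root, and
bounded vectors `x t` in `X` are such that the increments `z t = y t - y t⁻` satisfy
`z r (S (x t)) = 1` for `r = t` and `z r (S (x t)) = 0` otherwise, and such that `∑ |z t v|`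
converges for `v` in a dense set. Then `e_t ↦ x t` and `v ↦ (s ↦ y s v)` factor `sigmaOp` through
`S`: the function `s ↦ y s v` is the sum of its increments along the branch below `s`, hence
`sigmaOp` applied to the family of increments when the latter is summable, and a uniform limit of
such functions in general. It is enough that the off-diagonal entries be small
(`factorsThrough_of_almost_biorthogonal`): the matrix then differs from the identity by a small
operator on `ℓ₁`, and can be inverted.

Such a system is built node by node, in an order of type `ω` that respects the tree
(`exists_isAdmissiblePair`). The functional `y t` is taken in a transfinite iterate of the
derivation of the dual ball for the seminorm `y ↦ ‖y ∘ S‖`, of order at least the rank of `t`.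
As `y t⁻` belongs to a later iterate, `y t` may be chosen weak-star close to it with
`‖(y t - y t⁻) ∘ S‖` bounded below. A unit vector on which the increment is large is then corrected
by an element of a finite net, chosen beforehand, of the ball with respect to the earlier
increments (`exists_next_pair`).

It remains to find `0` in an iterate of the dual ball of order at least the rank of the tree. If
`S` is not `α`-Szlenk, some iterate of order `ω ^ α` of `S^*(B_{Y^*})` is nonempty. By weak-star
compactness it lifts to the dual ball of `Y` (`exists_mem_seminormIter_of_mem_szlenkIter`), and by
absolute convexity the iterates of order `ω ^ α * n` contain `0`, for separation constants
depending on `n` (`exists_smul_mem_seminormIter_mul`). Since the rank of the tree is less than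
`ω ^ (α + 1)`, it is less than some `ω ^ α * n`.

For a blossomed tree, the evaluations at the immediate successors of `t` converge weak-star to the
evaluation at `t` while their compositions with `sigmaOp` stay at distance at least `1`; so the
evaluation at the root survives as many derivations as the rank of the root
(`evalC0_comp_sigmaOp_mem_szlenkIter`), which gives the membership of `sigmaOp` in the class.
-/

noncomputable section

namespace SzlenkTree

/-! ### Powers of `ω` in different universes -/

theorem lift_omega0_opow (a : Ordinal.{v}) :
    Ordinal.lift.{u} (ω ^ a) = ω ^ Ordinal.lift.{u} a := by
  induction a using Ordinal.limitRecOn with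
  | zero => simp
  | add_one a ih =>
    rw [← Order.succ_eq_add_one, Ordinal.opow_succ, Ordinal.lift_mul, ih, Ordinal.lift_succ,
      Ordinal.opow_succ, Ordinal.lift_omega0]
  | limit a ha ih =>
    refine le_antisymm ?_ ?_
    · by_contra! hlt
      obtain ⟨z, hz, hz'⟩ := Ordinal.lt_lift_iff.1 hlt
      obtain ⟨b, hb, hzb⟩ := (Ordinal.lt_opow_of_isSuccLimit Ordinal.omega0_ne_zero ha).1 hz
      have h1 := Ordinal.lift_lt.{u, v}.2 hzb
      rw [ih b hb, hz'] at h1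
      exact h1.not_ge (Ordinal.opow_le_opow_right Ordinal.omega0_pos (Ordinal.lift_le.2 hb.le))
    · refine (Ordinal.opow_le_of_isSuccLimit Ordinal.omega0_ne_zero
        (Ordinal.isSuccLimit_lift.2 ha)).2 fun b' hb' => ?_
      obtain ⟨b, hb, rfl⟩ := Ordinal.lt_lift_iff.1 hb'
      rw [← ih b hb]
      exact Ordinal.lift_le.2 (Ordinal.opow_le_opow_right Ordinal.omega0_pos hb.le)

/-! ### Transfinite iterates of the Szlenk derivation -/

section SzlenkIterates

variable {𝕜 : Type w} [RCLike 𝕜] {X : Type u} [NormedAddCommGroup X] [NormedSpace 𝕜 X]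

/-- The three clauses of the transfinite recursion amount to the single condition that a point of
the `ξ`-th iterate survives one more derivation of each earlier iterate. -/
theorem mem_szlenkIter_iff {ε : ℝ} {K : Set (StrongDual 𝕜 X)} {ξ : Ordinal.{v}}
    {x : StrongDual 𝕜 X} :
    x ∈ szlenkIter ε K ξ ↔ x ∈ K ∧ ∀ ζ < ξ, x ∈ szlenkDeriv ε (szlenkIter ε K ζ) := by
  induction ξ using Ordinal.limitRecOn with
  | zero => simp [szlenkIter]
  | add_one ξ ih =>
    have hs : szlenkIter ε K (ξ + 1) = szlenkDeriv ε (szlenkIter ε K ξ) :=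
      Ordinal.limitRecOn_add_one ..
    rw [hs]
    refine ⟨fun h => ⟨(ih.1 h.1).1, fun ζ hζ => ?_⟩,
      fun h => h.2 ξ (Order.lt_add_one_iff.2 le_rfl)⟩
    rcases (Order.lt_add_one_iff.1 hζ).lt_or_eq with h' | rfl
    · exact (ih.1 h.1).2 ζ h'
    · exact h
  | limit ξ hξ ih =>
    have hs : szlenkIter ε K ξ = ⋂ (ζ) (_ : ζ < ξ), szlenkIter ε K ζ :=
      Ordinal.limitRecOn_limit _ _ _ _ hξ
    rw [hs]
    simp only [Set.mem_iInter]
    refine ⟨fun h => ⟨?_, fun ζ hζ => ?_⟩, fun h ζ hζ => ?_⟩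
    · exact ((ih 0 hξ.bot_lt).1 (h 0 hξ.bot_lt)).1
    · have hs' : szlenkIter ε K (ζ + 1) = szlenkDeriv ε (szlenkIter ε K ζ) :=
        Ordinal.limitRecOn_add_one ..
      rw [← hs']
      exact h (ζ + 1) (hξ.add_one_lt hζ)
    · exact (ih ζ hζ).2 ⟨h.1, fun η hη => h.2 η (hη.trans hζ)⟩

theorem szlenkIter_antitone (ε : ℝ) (K : Set (StrongDual 𝕜 X)) :
    Antitone (szlenkIter ε K : Ordinal.{v} → _) := fun _ _ h _ hx =>
  mem_szlenkIter_iff.2 ⟨(mem_szlenkIter_iff.1 hx).1,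
    fun η hη => (mem_szlenkIter_iff.1 hx).2 η (hη.trans_le h)⟩

theorem szlenkIter_lift (ε : ℝ) (K : Set (StrongDual 𝕜 X)) (ξ : Ordinal.{v}) :
    szlenkIter ε K (Ordinal.lift.{v'} ξ) = szlenkIter ε K ξ := by
  induction ξ using WellFoundedLT.induction with
  | ind ξ ih =>
    ext x
    rw [mem_szlenkIter_iff, mem_szlenkIter_iff]
    refine and_congr_right fun _ => ⟨fun h ζ hζ => ?_, fun h ζ hζ => ?_⟩
    · rw [← ih ζ hζ]
      exact h _ (Ordinal.lift_lt.2 hζ)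
    · obtain ⟨ζ', hζ', rfl⟩ := Ordinal.lt_lift_iff.1 hζ
      rw [ih ζ' hζ']
      exact h ζ' hζ'

/-- `Sz(K)` exceeds `β` exactly when, for some `ε`, the `β`-th iterate is still nonempty. -/
theorem not_szlenkIndex_le_iff {K : Set (StrongDual 𝕜 X)} {β : Ordinal.{u}} :
    ¬ szlenkIndex K ≤ (β : WithTop Ordinal.{u}) ↔
      ∃ ε : ℝ, 0 < ε ∧ (szlenkIter ε K β).Nonempty := by
  refine ⟨fun h => ?_, ?_⟩
  · by_contra! hne
    refine h (iSup₂_le fun ε hε => sInf_le ⟨β, rfl, hne ε hε⟩)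
  · rintro ⟨ε, hε, hne⟩ h
    have h1 : szlenkIndexEps K ε ≤ (β : WithTop Ordinal.{u}) :=
      (le_iSup₂ (f := fun (ε : ℝ) (_ : 0 < ε) => szlenkIndexEps K ε) ε hε).trans h
    have h2 : ((β + 1 : Ordinal.{u}) : WithTop Ordinal.{u}) ≤ szlenkIndexEps K ε := by
      refine le_sInf ?_
      rintro _ ⟨ξ, rfl, hξ⟩
      rw [WithTop.coe_le_coe, Order.add_one_le_iff]
      by_contra! hle
      exact (hne.mono (szlenkIter_antitone ε K hle)).ne_empty hξ
    have h3 := WithTop.coe_le_coe.1 (h2.trans h1)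
    exact absurd h3 (by simp)

end SzlenkIterates

/-! ### The derivation of a seminorm on a topological vector space -/

section SeminormDerivation

variable {𝕜 : Type w} [RCLike 𝕜] {E : Type u} [AddCommGroup E] [Module 𝕜 E] [TopologicalSpace E]

/-- All points of `L` each of whose neighbourhoods meets `L` in a set of `p`-diameter greater
than `δ`. -/
def seminormDeriv (p : Seminorm 𝕜 E) (δ : ℝ) (L : Set E) : Set E :=
  {y | y ∈ L ∧ ∀ U : Set E, IsOpen U → y ∈ U → ∃ a ∈ U ∩ L, ∃ b ∈ U ∩ L, δ < p (a - b)}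

/-- The transfinite iterates of `seminormDeriv p δ`. The recursion is written with a single clause:
a point belongs to the `ξ`-th iterate if it survives the derivation of every earlier one. -/
def seminormIter (p : Seminorm 𝕜 E) (δ : ℝ) (L : Set E) (ξ : Ordinal.{v}) : Set E :=
  {y | y ∈ L ∧ ∀ ζ, ∀ _ : ζ < ξ, y ∈ seminormDeriv p δ (seminormIter p δ L ζ)}
termination_by ξ

variable {p : Seminorm 𝕜 E} {δ δ' : ℝ} {L L' : Set E}

theorem mem_seminormIter_iff {ξ : Ordinal.{v}} {y : E} :
    y ∈ seminormIter p δ L ξ ↔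
      y ∈ L ∧ ∀ ζ < ξ, y ∈ seminormDeriv p δ (seminormIter p δ L ζ) := by
  rw [seminormIter]
  rfl

theorem seminormIter_antitone (p : Seminorm 𝕜 E) (δ : ℝ) (L : Set E) :
    Antitone (seminormIter p δ L : Ordinal.{v} → _) := fun _ _ h _ hx =>
  mem_seminormIter_iff.2 ⟨(mem_seminormIter_iff.1 hx).1,
    fun η hη => (mem_seminormIter_iff.1 hx).2 η (hη.trans_le h)⟩

theorem seminormIter_subset (ξ : Ordinal.{v}) : seminormIter p δ L ξ ⊆ L :=
  fun _ hx => (mem_seminormIter_iff.1 hx).1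

/-- A continuous map that carries `L` into `L'` and pairs at distance more than `δ` to pairs at
distance more than `δ'` carries the iterates for `δ` into those for `δ'`. -/
theorem map_mem_seminormIter {φ : E → E} (hφ : Continuous φ) (hL : Set.MapsTo φ L L')
    (hp : ∀ a b, δ < p (a - b) → δ' < p (φ a - φ b)) {ξ : Ordinal.{v}} {x : E}
    (hx : x ∈ seminormIter p δ L ξ) : φ x ∈ seminormIter p δ' L' ξ := by
  induction ξ using WellFoundedLT.induction generalizing x with
  | ind ξ ih =>
    rw [mem_seminormIter_iff] at hx ⊢
    refine ⟨hL hx.1, fun ζ hζ => ⟨ih ζ hζ (hx.2 ζ hζ).1, fun U hU hxU => ?_⟩⟩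
    obtain ⟨a, ha, b, hb, hab⟩ := (hx.2 ζ hζ).2 (φ ⁻¹' U) (hU.preimage hφ) hxU
    exact ⟨φ a, ⟨ha.1, ih ζ hζ ha.2⟩, φ b, ⟨hb.1, ih ζ hζ hb.2⟩, hp a b hab⟩

theorem seminormDeriv_mono (h : L ⊆ L') : seminormDeriv p δ L ⊆ seminormDeriv p δ L' :=
  fun _ hy => ⟨h hy.1, fun U hU hyU => by
    obtain ⟨a, ha, b, hb, hab⟩ := hy.2 U hU hyU
    exact ⟨a, ⟨ha.1, h ha.2⟩, b, ⟨hb.1, h hb.2⟩, hab⟩⟩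

theorem seminormIter_mono (h : L ⊆ L') (hδ : δ' ≤ δ) (ξ : Ordinal.{v}) :
    seminormIter p δ L ξ ⊆ seminormIter p δ' L' ξ := fun _ hx =>
  map_mem_seminormIter continuous_id h (fun _ _ hab => hδ.trans_lt hab) hx

theorem seminormIter_iter_subset (ξ ζ : Ordinal.{v}) :
    seminormIter p δ (seminormIter p δ L ξ) ζ ⊆ seminormIter p δ L (ξ + ζ) := by
  induction ζ using WellFoundedLT.induction with
  | ind ζ ih =>
    intro y hy
    rw [mem_seminormIter_iff] at hy
    refine mem_seminormIter_iff.2 ⟨seminormIter_subset _ hy.1, fun η hη => ?_⟩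
    rcases lt_or_ge η ξ with h | h
    · exact (mem_seminormIter_iff.1 hy.1).2 η h
    · obtain ⟨η', rfl⟩ := exists_add_of_le h
      have h' : η' < ζ := (add_lt_add_iff_left _).1 hη
      exact seminormDeriv_mono (ih η' h') (hy.2 η' h')

theorem isClosed_seminormDeriv (hL : IsClosed L) : IsClosed (seminormDeriv p δ L) := by
  refine isClosed_of_closure_subset fun y hy => ⟨?_, fun U hU hyU => ?_⟩
  · exact closure_minimal (fun _ h => h.1) hL hy
  · obtain ⟨y', hy'U, hy'⟩ := mem_closure_iff.1 hy U hU hyU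
    exact hy'.2 U hU hy'U

theorem isClosed_seminormIter (hL : IsClosed L) (ξ : Ordinal.{v}) :
    IsClosed (seminormIter p δ L ξ) := by
  induction ξ using WellFoundedLT.induction with
  | ind ξ ih =>
    have : seminormIter p δ L ξ =
        L ∩ ⋂ (ζ) (_ : ζ < ξ), seminormDeriv p δ (seminormIter p δ L ζ) := by
      ext y
      rw [mem_seminormIter_iff]
      simp
    rw [this]
    exact hL.inter (isClosed_iInter fun ζ => isClosed_iInter fun hζ =>
      isClosed_seminormDeriv (ih ζ hζ))

/-- One of the two points provided by the derivation is at distance more than `δ / 2` from `y`. -/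
theorem exists_far_mem {ξ ζ : Ordinal.{v}} {y : E} (hy : y ∈ seminormIter p δ L ξ) (hζ : ζ < ξ)
    {U : Set E} (hU : IsOpen U) (hyU : y ∈ U) :
    ∃ a ∈ seminormIter p δ L ζ, a ∈ U ∧ δ / 2 < p (a - y) := by
  obtain ⟨a, ha, b, hb, hab⟩ := ((mem_seminormIter_iff.1 hy).2 ζ hζ).2 U hU hyU
  by_contra! h
  have h1 := h a ha.2 ha.1
  have h2 := h b hb.2 hb.1
  have h3 : p (a - b) ≤ p (a - y) + p (b - y) := by
    have := map_sub_le_add p (a - y) (b - y)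
    rwa [sub_sub_sub_cancel_right] at this
  linarith

variable [IsTopologicalAddGroup E] [ContinuousConstSMul 𝕜 E]

/-- In a midpoint-convex symmetric set, one nonempty iterate of order `ξ` yields, at the price of a
smaller separation constant, a homothetic copy of the whole set inside the iterate of order
`ξ * n`. Averaging a point of the iterate with its opposite puts `0` in the iterate, averaging
`0` with an arbitrary point then handles `n = 1`, and self-similarity does the rest. -/
theorem exists_smul_mem_seminormIter_mul
    (hmid : ∀ x ∈ L, ∀ y ∈ L, (2⁻¹ : 𝕜) • (x + y) ∈ L) (hneg : ∀ x ∈ L, -x ∈ L)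
    (hδ : 0 < δ) {ξ : Ordinal.{v}} (hne : (seminormIter p δ L ξ).Nonempty) (n : ℕ) :
    ∃ δ' > 0, ∃ c : 𝕜, c ≠ 0 ∧ ∀ y ∈ L, c • y ∈ seminormIter p δ' L (ξ * n) := by
  have hav : ∀ {r : ℝ} {x y : E}, x ∈ seminormIter p r L ξ → y ∈ L →
      (2⁻¹ : 𝕜) • (x + y) ∈ seminormIter p (r / 2) L ξ := by
    intro r x y hx hy
    refine map_mem_seminormIter (φ := fun a => (2⁻¹ : 𝕜) • (a + y)) (by fun_prop)
      (fun a ha => hmid a ha y hy) (fun a b hab => ?_) hx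
    have : (2⁻¹ : 𝕜) • (a + y) - (2⁻¹ : 𝕜) • (b + y) = (2⁻¹ : 𝕜) • (a - b) := by
      rw [← smul_sub, add_sub_add_right_eq_sub]
    rw [this, map_smul_eq_mul, norm_inv, RCLike.norm_ofNat]
    linarith
  obtain ⟨x, hx⟩ := hne
  have hzero : (0 : E) ∈ seminormIter p (δ / 2) L ξ := by
    have := hav hx (hneg x (seminormIter_subset _ hx))
    rwa [add_neg_cancel, smul_zero] at this
  have hhalf : ∀ y ∈ L, (2⁻¹ : 𝕜) • y ∈ seminormIter p (δ / 2 / 2) L ξ := fun y hy => by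
    have := hav hzero hy
    rwa [zero_add] at this
  induction n with
  | zero => exact ⟨1, one_pos, 1, one_ne_zero, fun y hy => by
      rw [one_smul]
      exact mem_seminormIter_iff.2 ⟨hy, fun ζ hζ => absurd hζ (by simp)⟩⟩
  | succ n ih =>
    obtain ⟨r, hr, c, hc, h⟩ := ih
    have hc' := norm_pos_iff.2 hc
    refine ⟨min r (‖c‖ * (δ / 2 / 2)), by positivity, c * 2⁻¹, by simp [hc], fun y hy => ?_⟩
    rw [Nat.cast_succ, mul_add_one]
    refine seminormIter_iter_subset _ _ ?_
    rw [mul_smul]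
    refine map_mem_seminormIter (φ := fun a => c • a) (by fun_prop)
      (fun a ha => seminormIter_mono subset_rfl (min_le_left _ _) _ (h a ha))
      (fun a b hab => ?_) (hhalf y hy)
    rw [← smul_sub, map_smul_eq_mul]
    exact (min_le_right _ _).trans_lt (mul_lt_mul_of_pos_left hab hc')

end SeminormDerivation

/-! ### Lifting derivations along an adjoint operator -/

section Lifting

variable {𝕜 : Type w} [RCLike 𝕜] {X : Type u} [NormedAddCommGroup X] [NormedSpace 𝕜 X]
  {Y : Type v} [NormedAddCommGroup Y] [NormedSpace 𝕜 Y]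

/-- The seminorm `y ↦ ‖y ∘ S‖` on the dual of the codomain of `S`. -/
def adjointSeminorm (S : X →L[𝕜] Y) : Seminorm 𝕜 (WeakDual 𝕜 Y) :=
  (normSeminorm 𝕜 (StrongDual 𝕜 X)).comp
    (((ContinuousLinearMap.compL 𝕜 X Y 𝕜).flip S).toLinearMap.comp
      (WeakDual.toStrongDual : WeakDual 𝕜 Y ≃ₗ[𝕜] StrongDual 𝕜 Y).toLinearMap)

theorem adjointSeminorm_apply (S : X →L[𝕜] Y) (y : WeakDual 𝕜 Y) :
    adjointSeminorm S y = ‖(WeakDual.toStrongDual y).comp S‖ := rfl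

/-- The closed dual unit ball, as a subset of the weak-star dual. -/
def weakBall (𝕜 : Type w) [RCLike 𝕜] (Y : Type v) [NormedAddCommGroup Y] [NormedSpace 𝕜 Y] :
    Set (WeakDual 𝕜 Y) :=
  WeakDual.toStrongDual ⁻¹' Metric.closedBall 0 1

theorem isCompact_weakBall : IsCompact (weakBall 𝕜 Y) :=
  WeakDual.isCompact_closedBall 0 1

theorem mem_weakBall {y : WeakDual 𝕜 Y} : y ∈ weakBall 𝕜 Y ↔ ‖WeakDual.toStrongDual y‖ ≤ 1 := by
  simp [weakBall]

theorem continuous_weakAdjoint (S : X →L[𝕜] Y) :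
    Continuous fun y : WeakDual 𝕜 Y =>
      StrongDual.toWeakDual ((WeakDual.toStrongDual y).comp S) :=
  WeakDual.continuous_of_continuous_eval fun x => WeakDual.eval_continuous (S x)

/-- A point of the derivation of a set covered by `S^*(L)`, for `L` compact, lifts to a point of
the derivation of `L`. If each point of the fibre had a neighbourhood whose trace on `L` had small
diameter, then the images of these neighbourhoods would cover, by compactness, a weak-star
neighbourhood of the given point, all of it close to that point. -/
theorem exists_mem_seminormDeriv_of_mem_szlenkDeriv (S : X →L[𝕜] Y) {ε : ℝ}
    {L : Set (WeakDual 𝕜 Y)} (hL : IsCompact L) {K : Set (StrongDual 𝕜 X)}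
    (hK : ∀ k ∈ K, ∃ y ∈ L, (WeakDual.toStrongDual y).comp S = k)
    {k : StrongDual 𝕜 X} (hk : k ∈ szlenkDeriv ε K) :
    ∃ y ∈ seminormDeriv (adjointSeminorm S) (ε / 2) L, (WeakDual.toStrongDual y).comp S = k := by
  by_contra! hno
  have hU : ∀ y ∈ L, (WeakDual.toStrongDual y).comp S = k → ∃ U : Set (WeakDual 𝕜 Y),
      IsOpen U ∧ y ∈ U ∧ ∀ a ∈ U ∩ L, ∀ b ∈ U ∩ L, adjointSeminorm S (a - b) ≤ ε / 2 := by
    intro y hy hyk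
    by_contra! h
    exact hno y ⟨hy, h⟩ hyk
  choose! U hUo hyU hUs using hU
  set O : Set (WeakDual 𝕜 Y) :=
    ⋃ (y) (_ : y ∈ L ∧ (WeakDual.toStrongDual y).comp S = k), U y with hO
  have hOo : IsOpen O := isOpen_iUnion fun y => isOpen_iUnion fun hy => hUo y hy.1 hy.2
  have hC : IsClosed ((fun y : WeakDual 𝕜 Y =>
      StrongDual.toWeakDual ((WeakDual.toStrongDual y).comp S)) '' (L \ O)) :=
    ((hL.diff hOo).image (continuous_weakAdjoint S)).isClosed
  refine absurd (hk.2 _ hC.isOpen_compl ?_) (not_lt.2 ?_)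
  · rintro ⟨y, ⟨hyL, hyO⟩, hy⟩
    refine hyO (Set.mem_iUnion₂.2 ⟨y, ⟨hyL, ?_⟩, hyU y hyL ?_⟩) <;>
      exact StrongDual.toWeakDual.injective hy
  · have hclose : ∀ h ∈ StrongDual.toWeakDual ⁻¹' ((fun y : WeakDual 𝕜 Y =>
        StrongDual.toWeakDual ((WeakDual.toStrongDual y).comp S)) '' (L \ O))ᶜ ∩ K,
        ‖h - k‖ ≤ ε / 2 := by
      rintro h ⟨hh, hhK⟩
      obtain ⟨a, haL, rfl⟩ := hK h hhK
      have haO : a ∈ O := by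
        by_contra haO
        exact hh ⟨a, ⟨haL, haO⟩, rfl⟩
      obtain ⟨y, ⟨hyL, hyk⟩, hay⟩ := Set.mem_iUnion₂.1 haO
      have := hUs y hyL hyk a ⟨hay, haL⟩ y ⟨hyU y hyL hyk, hyL⟩
      rw [adjointSeminorm_apply, map_sub, ContinuousLinearMap.sub_comp, hyk] at this
      exact this
    refine Metric.ediam_le fun h hh h' hh' => ?_
    rw [edist_dist]
    refine ENNReal.ofReal_le_ofReal ?_
    have h1 := hclose h hh
    have h2 := hclose h' hh'
    rw [dist_eq_norm]
    have := norm_sub_le (h - k) (h' - k)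
    rw [sub_sub_sub_cancel_right] at this
    linarith

theorem exists_mem_seminormIter_of_mem_szlenkIter (S : X →L[𝕜] Y) {ε : ℝ} {ξ : Ordinal.{v'}}
    {k : StrongDual 𝕜 X} (hk : k ∈ szlenkIter ε (adjointBall S) ξ) :
    ∃ y ∈ seminormIter (adjointSeminorm S) (ε / 2) (weakBall 𝕜 Y) ξ,
      (WeakDual.toStrongDual y).comp S = k := by
  induction ξ using WellFoundedLT.induction generalizing k with
  | ind ξ ih =>
    rw [mem_szlenkIter_iff] at hk
    have hcl : ∀ ζ : Ordinal.{v'}, IsClosed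
        (seminormIter (adjointSeminorm S) (ε / 2) (weakBall 𝕜 Y) ζ) := fun ζ =>
      isClosed_seminormIter isCompact_weakBall.isClosed ζ
    have hstep : ∀ ζ < ξ, ∃ y ∈ seminormDeriv (adjointSeminorm S) (ε / 2)
        (seminormIter (adjointSeminorm S) (ε / 2) (weakBall 𝕜 Y) ζ),
        (WeakDual.toStrongDual y).comp S = k := fun ζ hζ =>
      exists_mem_seminormDeriv_of_mem_szlenkDeriv S
        (isCompact_weakBall.of_isClosed_subset (hcl ζ) (seminormIter_subset ζ))
        (fun _ => ih ζ hζ) (hk.2 ζ hζ)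
    rcases eq_or_ne ξ 0 with rfl | hξ
    · obtain ⟨g, hg, hgk⟩ := hk.1
      exact ⟨StrongDual.toWeakDual g, mem_seminormIter_iff.2
        ⟨mem_weakBall.2 (by simpa using hg), fun ζ hζ => absurd hζ (by simp)⟩, hgk⟩
    · -- The fibres over `k` in the earlier derivations form a decreasing family of compact sets.
      set F : Set.Iio ξ → Set (WeakDual 𝕜 Y) := fun ζ =>
        seminormDeriv (adjointSeminorm S) (ε / 2)
          (seminormIter (adjointSeminorm S) (ε / 2) (weakBall 𝕜 Y) (ζ : Ordinal.{v'})) ∩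
        (fun y : WeakDual 𝕜 Y => StrongDual.toWeakDual ((WeakDual.toStrongDual y).comp S)) ⁻¹'
          {StrongDual.toWeakDual k} with hF
      have hFcl : ∀ ζ, IsClosed (F ζ) := fun ζ => (isClosed_seminormDeriv (hcl ζ)).inter
        (isClosed_singleton.preimage (continuous_weakAdjoint S))
      have hFanti : Antitone F := fun ζ η h => Set.inter_subset_inter_left _
        (seminormDeriv_mono (seminormIter_antitone _ _ _ h))
      have : Nonempty (Set.Iio ξ) := ⟨⟨0, pos_iff_ne_zero.2 hξ⟩⟩
      obtain ⟨y, hy⟩ := IsCompact.nonempty_iInter_of_directed_nonempty_isCompact_isClosed F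
        (directed_of_isDirected_le hFanti)
        (fun ζ => by
          obtain ⟨y, hy, hyk⟩ := hstep ζ ζ.2
          exact ⟨y, hy, congrArg StrongDual.toWeakDual hyk⟩)
        (fun ζ => isCompact_weakBall.of_isClosed_subset (hFcl ζ)
          fun y hy => seminormIter_subset _ hy.1.1) hFcl
      have hy' := Set.mem_iInter.1 hy
      have hy0 := hy' ⟨0, pos_iff_ne_zero.2 hξ⟩
      exact ⟨y, mem_seminormIter_iff.2 ⟨seminormIter_subset _ hy0.1.1,
        fun ζ hζ => (hy' ⟨ζ, hζ⟩).1⟩, StrongDual.toWeakDual.injective hy0.2⟩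

/-- If some iterate of order `ξ` of `S^*(B_{Y^*})` is nonempty, then `0` lies in an iterate of
order `ξ * n` of the dual ball of the codomain. -/
theorem exists_zero_mem_seminormIter_mul (S : X →L[𝕜] Y) {ε : ℝ} (hε : 0 < ε)
    {ξ : Ordinal.{v'}} (h : (szlenkIter ε (adjointBall S) ξ).Nonempty) (n : ℕ) :
    ∃ δ > 0, (0 : WeakDual 𝕜 Y) ∈
      seminormIter (adjointSeminorm S) δ (weakBall 𝕜 Y) (ξ * n) := by
  obtain ⟨k, hk⟩ := h
  obtain ⟨y, hy, -⟩ := exists_mem_seminormIter_of_mem_szlenkIter S hk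
  have hmid : ∀ a ∈ weakBall 𝕜 Y, ∀ b ∈ weakBall 𝕜 Y, (2⁻¹ : 𝕜) • (a + b) ∈ weakBall 𝕜 Y := by
    intro a ha b hb
    rw [mem_weakBall] at *
    rw [map_smul, norm_smul, map_add, norm_inv, RCLike.norm_ofNat]
    have := norm_add_le (WeakDual.toStrongDual a) (WeakDual.toStrongDual b)
    linarith
  have hneg : ∀ a ∈ weakBall 𝕜 Y, -a ∈ weakBall 𝕜 Y := by
    intro a ha
    rw [mem_weakBall] at *
    rwa [map_neg, norm_neg]
  obtain ⟨δ, hδ, c, -, hc⟩ :=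
    exists_smul_mem_seminormIter_mul hmid hneg (half_pos hε) ⟨y, hy⟩ n
  refine ⟨δ, hδ, ?_⟩
  have := hc 0 (mem_weakBall.2 (by simp))
  rwa [smul_zero] at this

end Lifting

/-! ### Trees and their ranks -/

section TreeRank

variable {T : Type u} [PartialOrder T]

theorem finite_Iic [IsTree T] [IsWellFoundedTree T] (t : T) : (Set.Iic t).Finite :=
  finite_of_isChain (isChain_Iic t)

instance wellFoundedGT_of_isWellFoundedTree [IsWellFoundedTree T] : WellFoundedGT T := by
  refine ⟨RelEmbedding.wellFounded_iff_isEmpty.2 ⟨fun f => ?_⟩⟩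
  have hmono : StrictMono f := strictMono_nat_of_lt_succ fun n =>
    f.map_rel_iff.2 (show n + 1 > n from Nat.lt_succ_self n)
  have hchain : IsChain (· ≤ ·) (Set.range f) := by
    rintro _ ⟨m, rfl⟩ _ ⟨n, rfl⟩ -
    exact (le_total m n).imp (fun h => hmono.monotone h) fun h => hmono.monotone h
  exact Set.infinite_range_of_injective hmono.injective (finite_of_isChain hchain)

variable [IsWellFoundedTree T]

/-- The ordinal rank of a node for the reversed order, that is the least ordinal greater than the
ranks of all the larger nodes. It agrees with `nodeRank`, see `nodeRank_eq_revRank`. -/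
abbrev revRank (t : T) : Ordinal.{u} := IsWellFounded.rank (α := T) (· > ·) t

theorem add_one_le_revRank_iff {t : T} {ξ : Ordinal.{u}} :
    ξ + 1 ≤ revRank t ↔ ∃ s, t < s ∧ ξ ≤ revRank s := by
  rw [Order.add_one_le_iff, revRank, IsWellFounded.rank_eq]
  constructor
  · intro h
    obtain ⟨⟨s, hs⟩, hξ⟩ := (Ordinal.lt_iSup_iff).1 h
    exact ⟨s, hs, Order.lt_succ_iff.1 hξ⟩
  · rintro ⟨s, hs, hξ⟩
    exact (Order.lt_succ_iff.2 hξ).trans_le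
      (Ordinal.le_iSup (fun b : {b // b > t} => Order.succ (IsWellFounded.rank (· > ·) b.1))
        ⟨s, hs⟩)

theorem mem_derivedTree_iff {t : T} {ξ : Ordinal.{u}} : t ∈ derivedTree T ξ ↔ ξ ≤ revRank t := by
  induction ξ using Ordinal.limitRecOn generalizing t with
  | zero => simp [derivedTree]
  | add_one ξ ih =>
    have hs : derivedTree T (ξ + 1) =
        derivedTree T ξ \ {t | Maximal (· ∈ derivedTree T ξ) t} :=
      Ordinal.limitRecOn_add_one ..
    rw [hs, add_one_le_revRank_iff]
    constructor
    · rintro ⟨h, hmax⟩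
      by_contra! hno
      refine hmax ⟨h, fun s hs hts => ?_⟩
      rcases hts.lt_or_eq with h' | rfl
      · exact absurd (ih.1 hs) (not_le.2 (hno s h'))
      · exact le_rfl
    · rintro ⟨s, hs, hξ⟩
      exact ⟨ih.2 (hξ.trans (WellFoundedGT.rank_strictAnti hs).le),
        fun hmax => hs.not_ge (hmax.2 (ih.2 hξ) hs.le)⟩
  | limit ξ hξ ih =>
    have hs : derivedTree T ξ = ⋂ (ζ) (_ : ζ < ξ), derivedTree T ζ :=
      Ordinal.limitRecOn_limit _ _ _ _ hξ
    rw [hs]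
    simp only [Set.mem_iInter]
    refine ⟨fun h => ?_, fun h ζ hζ => (ih ζ hζ).2 (hζ.le.trans h)⟩
    by_contra! hlt
    exact absurd ((ih _ (hξ.add_one_lt hlt)).1 (h _ (hξ.add_one_lt hlt))) (by simp)

theorem nodeRank_eq_revRank (t : T) : nodeRank t = revRank t := by
  have : {ξ | t ∈ derivedTree T ξ \ derivedTree T (ξ + 1)} = {revRank t} := by
    ext ξ
    rw [Set.mem_ofPred_eq, Set.mem_sdiff, mem_derivedTree_iff, mem_derivedTree_iff,
      Order.add_one_le_iff, not_lt, Set.mem_singleton_iff, le_antisymm_iff]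
  rw [nodeRank, this, csInf_singleton]

theorem revRank_lt_treeRank (t : T) : revRank t < treeRank T := by
  have hne : {ξ : Ordinal.{u} | derivedTree T ξ = ∅}.Nonempty := by
    refine ⟨⨆ t : T, (revRank t + 1), Set.eq_empty_of_forall_notMem fun t ht => ?_⟩
    have h1 := mem_derivedTree_iff.1 ht
    have h2 := (Ordinal.le_iSup (fun t : T => revRank t + 1) t).trans h1
    simp at h2
  by_contra! h
  have h1 := mem_derivedTree_iff.2 h
  rw [treeRank, csInf_mem hne] at h1
  exact h1

variable [IsTree T]

theorem exists_isMin_le (t : T) : ∃ m, IsMin m ∧ m ≤ t := by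
  obtain ⟨m, hm⟩ := (finite_Iic t).exists_minimal ⟨t, le_refl t⟩
  exact ⟨m, fun s hs => hm.le_of_le (le_trans hs hm.prop) hs, hm.prop⟩

variable [IsRooted T]

theorem le_of_isMin {m : T} (hm : IsMin m) (t : T) : m ≤ t := by
  obtain ⟨m', hm', h⟩ := exists_isMin_le t
  rwa [IsRooted.subsingleton_min hm hm']

theorem treeRank_le_revRank_add_one {m : T} (hm : IsMin m) : treeRank T ≤ revRank m + 1 := by
  refine csInf_le' (Set.eq_empty_of_forall_notMem fun t ht => ?_)
  have h1 := mem_derivedTree_iff.1 ht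
  rw [Order.add_one_le_iff] at h1
  rcases (le_of_isMin hm t).lt_or_eq with h | rfl
  · exact (WellFoundedGT.rank_strictAnti h).not_gt h1
  · exact lt_irrefl _ h1

end TreeRank

/-! ### Predecessors and enumerations -/

section Predecessor

variable {T : Type u} [PartialOrder T] [IsTree T] [IsWellFoundedTree T]

theorem exists_isGreatest_Iio (t : starTree T) : ∃ s, IsGreatest (Set.Iio (t : T)) s := by
  obtain ⟨s, hs⟩ := not_isMin_iff.1 t.2
  exact exists_isGreatest_of_isChain ((isChain_Iic (t : T)).mono fun s hs => le_of_lt hs) ⟨s, hs⟩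

/-- The immediate predecessor of a node other than the root. -/
def treePred (t : starTree T) : T := (exists_isGreatest_Iio t).choose

theorem treePred_lt (t : starTree T) : treePred t < t := (exists_isGreatest_Iio t).choose_spec.1

theorem lt_iff_le_treePred {t : starTree T} {s : T} : s < t ↔ s ≤ treePred t :=
  ⟨fun h => (exists_isGreatest_Iio t).choose_spec.2 h, fun h => h.trans_lt (treePred_lt t)⟩

/-- A countable well-founded tree has a numbering without repetitions in which every node comes
after its predecessors. -/
theorem exists_strictMono_injective [Countable T] :
    ∃ c : T → ℕ, StrictMono c ∧ Function.Injective c := by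
  classical
  obtain ⟨e, he⟩ := exists_injective_nat T
  -- Binary digits encode the finite set of predecessors.
  have hmem : ∀ s t : T, e s ∈ (finite_Iic t).toFinset.image e ↔ s ≤ t := fun s t => by
    simp [he.eq_iff]
  refine ⟨fun t => ∑ i ∈ (finite_Iic t).toFinset.image e, 2 ^ i, fun s t h => ?_, fun s t h => ?_⟩
  · refine Finset.sum_lt_sum_of_subset (i := e t) (fun i hi => ?_) ((hmem t t).2 le_rfl)
      (fun hi => h.not_ge ((hmem t s).1 hi)) (by positivity) fun _ _ _ => Nat.zero_le _
    obtain ⟨r, hr, rfl⟩ := Finset.mem_image.1 hi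
    exact (hmem r t).2 (((hmem r s).1 hi).trans h.le)
  · have h' := Finset.geomSum_injective le_rfl h
    exact le_antisymm ((hmem s t).1 (h' ▸ (hmem s s).2 le_rfl))
      ((hmem t s).1 (h' ▸ (hmem t t).2 le_rfl))

/-- Recursion along a numbering, for a choice that depends on the earlier choices. -/
theorem exists_forall_of_numbering {ι : Type*} {E : Type*} [Nonempty E] (c : ι → ℕ)
    (P : ι → (ι → E) → E → Prop)
    (hcongr : ∀ t f g e, (∀ s, c s < c t → f s = g s) → P t f e → P t g e)
    (hstep : ∀ t f, (∀ s, c s < c t → P s f (f s)) → ∃ e, P t f e) :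
    ∃ f : ι → E, ∀ t, P t f (f t) := by
  classical
  have hwf : WellFounded (fun s t => c s < c t) := (measure c).wf
  let F : (t : ι) → ((s : ι) → c s < c t → E) → E := fun t f =>
    Classical.epsilon (P t fun s => if h : c s < c t then f s h else Classical.arbitrary E)
  refine ⟨hwf.fix F, fun t => ?_⟩
  induction t using hwf.induction with
  | _ t ih =>
    rw [hwf.fix_eq]
    obtain ⟨e, he⟩ := hstep t _ ih
    refine hcongr t _ _ _ (fun s hs => ?_) (Classical.epsilon_spec (p := P t fun s =>
      if h : c s < c t then hwf.fix F s else Classical.arbitrary E) ⟨e, ?_⟩)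
    · rw [dif_pos hs]
    · exact hcongr t _ _ _ (fun s hs => by rw [dif_pos hs]) he

end Predecessor

/-! ### Operators on `ℓ₁` -/

section EllOne

variable {𝕜 : Type w} [RCLike 𝕜] {ι : Type u}

theorem norm_ellOne (x : lp (fun _ : ι => 𝕜) 1) : ‖x‖ = ∑' i, ‖x i‖ := by
  simpa using lp.norm_eq_tsum_rpow (by simp) x

/-- A summable family, as an element of `ℓ₁`. -/
def ellOneMk (m : ι → 𝕜) (hm : Summable fun i => ‖m i‖) : lp (fun _ : ι => 𝕜) 1 :=
  ⟨m, memℓp_gen (by simpa using hm)⟩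

theorem ellOneMk_apply (m : ι → 𝕜) (hm : Summable fun i => ‖m i‖) (i : ι) :
    ellOneMk m hm i = m i := rfl

variable {E : Type v} [NormedAddCommGroup E] [NormedSpace 𝕜 E]

theorem ellOne_ext [DecidableEq ι] {F G : lp (fun _ : ι => 𝕜) 1 →L[𝕜] E}
    (h : ∀ i, F (lp.single 1 i 1) = G (lp.single 1 i 1)) : F = G := by
  refine lp.ext_continuousLinearMap (by simp) fun i => ?_
  ext
  exact h i

variable [CompleteSpace E]

theorem summable_smul_of_bounded {f : ι → E} {C : ℝ} (hf : ∀ i, ‖f i‖ ≤ C)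
    (x : lp (fun _ : ι => 𝕜) 1) : Summable fun i => x i • f i := by
  refine Summable.of_norm_bounded ((summable_norm_ellOne x).mul_right C) fun i => ?_
  rw [norm_smul]
  exact mul_le_mul_of_nonneg_left (hf i) (norm_nonneg _)

/-- The operator on `ℓ₁` that sends the unit vectors to a given bounded family. -/
def ellOneLift (f : ι → E) (C : ℝ) (hf : ∀ i, ‖f i‖ ≤ C) : lp (fun _ : ι => 𝕜) 1 →L[𝕜] E :=
  LinearMap.mkContinuous
    { toFun := fun x => ∑' i, x i • f i
      map_add' := fun x y => by
        rw [← (summable_smul_of_bounded hf x).tsum_add (summable_smul_of_bounded hf y)]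
        exact tsum_congr fun t => by rw [lp.coeFn_add, Pi.add_apply, add_smul]
      map_smul' := fun c x => by
        rw [RingHom.id_apply, ← (summable_smul_of_bounded hf x).tsum_const_smul c]
        exact tsum_congr fun t => by
          rw [lp.coeFn_smul, Pi.smul_apply, smul_eq_mul, mul_smul] }
    C fun x => by
      rw [norm_ellOne, ← tsum_mul_left]
      refine tsum_of_norm_bounded ((summable_norm_ellOne x).mul_left C).hasSum fun i => ?_
      rw [norm_smul, mul_comm]
      exact mul_le_mul_of_nonneg_right (hf i) (norm_nonneg _)

theorem norm_ellOneLift_le {f : ι → E} {C : ℝ} (hC : 0 ≤ C) (hf : ∀ i, ‖f i‖ ≤ C) :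
    ‖(ellOneLift f C hf : lp (fun _ : ι => 𝕜) 1 →L[𝕜] E)‖ ≤ C :=
  LinearMap.mkContinuous_norm_le _ hC _

theorem ellOneLift_single [DecidableEq ι] {f : ι → E} {C : ℝ} (hf : ∀ i, ‖f i‖ ≤ C) (i : ι) :
    (ellOneLift f C hf : lp (fun _ : ι => 𝕜) 1 →L[𝕜] E) (lp.single 1 i 1) = f i := by
  change ∑' j, (lp.single 1 i (1 : 𝕜) : lp (fun _ : ι => 𝕜) 1) j • f j = _
  rw [tsum_eq_single i fun s hs => by rw [lp.single_apply_ne _ _ _ hs, zero_smul],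
    lp.single_apply_self, one_smul]

end EllOne

/-! ### Functions on the tree given by their increments -/

section Increments

variable {𝕜 : Type w} [RCLike 𝕜] {T : Type u} [PartialOrder T]

/-- Evaluation at a node, as a functional on `C₀(T)`. -/
def evalC0 (s : T) : C0 𝕜 T →L[𝕜] 𝕜 :=
  (ContinuousMap.evalCLM 𝕜 (CoarseWedge.of s)).comp (C0 𝕜 T).subtypeL

variable [IsTree T] [IsWellFoundedTree T]

open Classical in
theorem evalC0_wedgeIndicator (s : T) (t : starTree T) :
    evalC0 s (wedgeIndicator 𝕜 t) = if (t : T) ≤ s then 1 else 0 :=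
  (Set.indicator_apply (Set.Ici (CoarseWedge.of (t : T))) (fun _ => (1 : 𝕜))
    (CoarseWedge.of s)).trans (if_congr Iff.rfl rfl rfl)

variable [IsRooted T]

open Classical in
theorem hasSum_evalC0_sigmaOp (s : T) (x : EllOneStar 𝕜 T) :
    HasSum (fun t : starTree T => if (t : T) ≤ s then x t else 0)
      (evalC0 s (sigmaOp 𝕜 T x)) := by
  have h : HasSum (fun t => x t • wedgeIndicator 𝕜 t) (sigmaOp 𝕜 T x) :=
    (summable_smul_wedge x).hasSum
  convert (evalC0 s).hasSum h using 2 with t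
  rw [map_smul, evalC0_wedgeIndicator, smul_eq_mul, mul_ite, mul_one, mul_zero]

/-- A function on the tree that vanishes at the root and whose increments are the coordinates of
`x` is `sigmaOp x`. -/
theorem eq_evalC0_sigmaOp (x : EllOneStar 𝕜 T) {h : T → 𝕜} (h0 : ∀ t, IsMin t → h t = 0)
    (hx : ∀ t : starTree T, h t = h (treePred t) + x t) (s : T) :
    h s = evalC0 s (sigmaOp 𝕜 T x) := by
  classical
  refine HasSum.unique ?_ (hasSum_evalC0_sigmaOp s x)
  obtain ⟨c, hc⟩ : ∃ c : T → ℕ, StrictMono c :=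
    ⟨fun t => (finite_Iic t).toFinset.card, fun a b hab => Finset.card_lt_card (by
      simpa using Set.Iic_ssubset_Iic.2 hab)⟩
  induction hn : c s using Nat.strong_induction_on generalizing s with
  | _ n ih =>
    by_cases hs : IsMin s
    · rw [h0 s hs]
      convert hasSum_zero with t
      exact if_neg fun hts => t.2 (hs.mono hts)
    · have hlt := treePred_lt (⟨s, hs⟩ : starTree T)
      have h1 := ih _ (hn ▸ hc hlt) _ rfl
      have h2 := h1.add (hasSum_ite_eq (⟨s, hs⟩ : starTree T) (x ⟨s, hs⟩))
      rw [← hx ⟨s, hs⟩] at h2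
      convert h2 using 2 with t
      by_cases hts : t = ⟨s, hs⟩
      · subst hts
        simp [hlt.not_ge]
      · rw [if_neg hts, add_zero]
        refine if_congr ?_ rfl rfl
        rw [← lt_iff_le_treePred]
        exact ⟨fun h' => lt_of_le_of_ne h' fun h'' => hts (Subtype.ext h''), le_of_lt⟩

end Increments

/-! ### Factorization from an almost biorthogonal system -/

section Factorization

variable {𝕜 : Type w} [RCLike 𝕜] {T : Type u} [PartialOrder T] [IsTree T] [IsRooted T]
  [IsWellFoundedTree T]
  {X : Type v} [NormedAddCommGroup X] [NormedSpace 𝕜 X] [CompleteSpace X]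
  {Y : Type v'} [NormedAddCommGroup Y] [NormedSpace 𝕜 Y]

/-- A bounded family of functionals, whose increments are summable on a dense set of vectors,
defines an operator into `C₀(T)`: the functions it produces are uniform limits of functions in the
range of `sigmaOp`. -/
theorem exists_clm_evalC0 (y : T → StrongDual 𝕜 Y) (hy : ∀ t, ‖y t‖ ≤ 1)
    (h0 : ∀ t, IsMin t → y t = 0) {D : Set Y} (hD : Dense D)
    (hsum : ∀ v ∈ D, Summable fun t : starTree T => ‖y t v - y (treePred t) v‖) :
    ∃ V : Y →L[𝕜] C0 𝕜 T, ∀ v s, evalC0 s (V v) = y s v := by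
  have hcont : ∀ v : Y, Continuous fun s : CoarseWedge T => y (CoarseWedge.of.symm s) v := by
    intro v
    refine continuous_of_uniform_approx_of_continuous fun W hW => ?_
    obtain ⟨ε, hε, hW⟩ := Metric.mem_uniformity_dist.1 hW
    obtain ⟨d, hdv, hd⟩ := Metric.dense_iff.1 hD v ε hε
    refine ⟨fun s => y (CoarseWedge.of.symm s) d, ?_, fun s => hW ?_⟩
    · let m : EllOneStar 𝕜 T := ellOneMk _ (hsum d hd)
      have hm : ∀ s, y s d = evalC0 s (sigmaOp 𝕜 T m) := eq_evalC0_sigmaOp m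
        (fun t ht => by rw [h0 t ht]; rfl) fun t => (add_sub_cancel _ _).symm
      exact (sigmaOp 𝕜 T m : C(CoarseWedge T, 𝕜)).continuous.congr fun s => (hm _).symm
    · rw [dist_eq_norm, ← map_sub]
      refine ((y _).le_of_opNorm_le (hy _) _).trans_lt ?_
      rwa [one_mul, ← dist_eq_norm, dist_comm]
  refine ⟨LinearMap.mkContinuous
    { toFun := fun v => ⟨⟨_, hcont v⟩, fun t ht => ?_⟩
      map_add' := fun v v' => ?_
      map_smul' := fun a v => ?_ } 1 fun v => ?_, fun v s => rfl⟩
  · change y t v = 0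
    rw [h0 t ht]
    rfl
  · ext s
    exact map_add (y _) _ _
  · ext s
    exact map_smul (y _) _ _
  · refine (ContinuousMap.norm_le _ (by positivity)).2 fun s => ?_
    exact (y _).le_of_opNorm_le (hy _) _

/-- The factorization criterion. The matrix of the system differs from the identity by an operator
of norm at most `1 / 2` on `ℓ₁`, and inverting it makes the system biorthogonal. -/
theorem factorsThrough_of_almost_biorthogonal (S : X →L[𝕜] Y)
    (y : T → StrongDual 𝕜 Y) (hy : ∀ t, ‖y t‖ ≤ 1) (h0 : ∀ t, IsMin t → y t = 0)
    {D : Set Y} (hD : Dense D)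
    (hsum : ∀ v ∈ D, Summable fun t : starTree T => ‖y t v - y (treePred t) v‖)
    (x : starTree T → X) {C : ℝ} (hx : ∀ t, ‖x t‖ ≤ C)
    (hdiag : ∀ t : starTree T, y t (S (x t)) - y (treePred t) (S (x t)) = 1)
    {e : starTree T → ℝ} (e0 : ∀ r, 0 ≤ e r) (he : Summable e) (he' : ∑' t, e t ≤ 1 / 2)
    (hoff : ∀ r t : starTree T, r ≠ t → ‖y r (S (x t)) - y (treePred r) (S (x t))‖ ≤ e r) :
    FactorsThrough (sigmaOp 𝕜 T) S := by
  classical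
  obtain ⟨V, hV⟩ := exists_clm_evalC0 y hy h0 hD hsum
  set n : starTree T → starTree T → 𝕜 := fun t r =>
    if r = t then 0 else y r (S (x t)) - y (treePred r) (S (x t)) with hn
  have hne : ∀ t r, ‖n t r‖ ≤ e r := fun t r => by
    by_cases h : r = t
    · simpa [hn, h] using e0 r
    · simpa [hn, h] using hoff r t h
  have hns : ∀ t, Summable fun r => ‖n t r‖ := fun t =>
    Summable.of_nonneg_of_le (fun _ => norm_nonneg _) (hne t) he
  obtain ⟨N, hN, hNs⟩ : ∃ N : EllOneStar 𝕜 T →L[𝕜] EllOneStar 𝕜 T, ‖-N‖ < 1 ∧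
      ∀ t, N (lp.single 1 t 1) = ellOneMk (n t) (hns t) := by
    have hb : ∀ t, ‖ellOneMk (n t) (hns t)‖ ≤ 1 / 2 := fun t => by
      rw [norm_ellOne]
      exact ((hns t).tsum_le_tsum (hne t) he).trans he'
    refine ⟨ellOneLift _ (1 / 2) hb, ?_, ellOneLift_single hb⟩
    rw [norm_neg]
    exact (norm_ellOneLift_le (by norm_num) _).trans_lt (by norm_num)
  have key : V ∘L S ∘L ellOneLift x C hx = (sigmaOp 𝕜 T) ∘L (1 - -N) := by
    refine ellOne_ext fun t => ?_
    have h1 : (1 - -N) (lp.single 1 t 1) =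
        lp.single 1 t 1 + ellOneMk (n t) (hns t) := by
      rw [sub_neg_eq_add, ← hNs]
      rfl
    rw [ContinuousLinearMap.comp_apply, ContinuousLinearMap.comp_apply, ellOneLift_single,
      ContinuousLinearMap.comp_apply, h1]
    ext s
    refine (hV _ (CoarseWedge.of.symm s)).trans (eq_evalC0_sigmaOp _
      (h := fun s => y s (S (x t))) (fun t ht => by rw [h0 t ht]; rfl) (fun r => ?_) _)
    rw [lp.coeFn_add, Pi.add_apply, ← sub_eq_iff_eq_add']
    by_cases h : r = t
    · subst h
      simp [hn, hdiag, ellOneMk_apply]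
    · simp [hn, h, ellOneMk_apply]
  refine ⟨(ellOneLift x C hx) ∘L
    ((Units.oneSub (-N) hN)⁻¹ : (EllOneStar 𝕜 T →L[𝕜] EllOneStar 𝕜 T)ˣ),
    V, ?_⟩
  have h2 : (1 - -N) ∘L
      (((Units.oneSub (-N) hN)⁻¹ : (EllOneStar 𝕜 T →L[𝕜] EllOneStar 𝕜 T)ˣ) :
        EllOneStar 𝕜 T →L[𝕜] EllOneStar 𝕜 T) = 1 := (Units.oneSub (-N) hN).mul_inv
  calc _ = (V ∘L S ∘L ellOneLift x C hx) ∘L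
        (((Units.oneSub (-N) hN)⁻¹ : (EllOneStar 𝕜 T →L[𝕜] EllOneStar 𝕜 T)ˣ) :
          EllOneStar 𝕜 T →L[𝕜] EllOneStar 𝕜 T) := rfl
    _ = _ := by rw [key, ContinuousLinearMap.comp_assoc, h2]; rfl

end Factorization

/-! ### Construction of the almost biorthogonal system -/

section Construction

variable {𝕜 : Type w} [RCLike 𝕜]
  {X : Type v} [NormedAddCommGroup X] [NormedSpace 𝕜 X]

/-- For finitely many functionals, finitely many vectors of the unit ball approximate all of them.
-/
theorem exists_finite_approx_ball {ι : Type*} [Finite ι] (f : ι → StrongDual 𝕜 X) {τ : ℝ}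
    (hτ : 0 < τ) : ∃ A : Set X, A.Finite ∧ (∀ a ∈ A, ‖a‖ ≤ 1) ∧
      ∀ x, ‖x‖ ≤ 1 → ∃ a ∈ A, ∀ i, ‖f i (x - a)‖ < τ := by
  have := Fintype.ofFinite ι
  set F : X →L[𝕜] ι → 𝕜 := ContinuousLinearMap.pi f with hF
  have hb : Bornology.IsBounded (F '' Metric.closedBall (0 : X) 1) :=
    F.lipschitz.isBounded_image Metric.isBounded_closedBall
  obtain ⟨t, ht, htf, hcover⟩ := Metric.finite_approx_of_totallyBounded
    (hb.isCompact_closure.totallyBounded.subset subset_closure) τ hτ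
  obtain ⟨A, hA, hAf, rfl⟩ := htf.exists_subset_finite_image_eq ht
  refine ⟨A, hAf, fun a ha => mem_closedBall_zero_iff.1 (hA ha), fun x hx => ?_⟩
  obtain ⟨_, ⟨a, ha, rfl⟩, hxa⟩ := Set.mem_iUnion₂.1
    (hcover ⟨x, mem_closedBall_zero_iff.2 hx, rfl⟩)
  refine ⟨a, ha, fun i => ?_⟩
  rw [Metric.mem_ball, dist_eq_norm, ← map_sub] at hxa
  exact (norm_le_pi_norm (F (x - a)) i).trans_lt hxa

variable {Y : Type v'} [NormedAddCommGroup Y] [NormedSpace 𝕜 Y]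

/-- One step of the construction. A functional `y` close to `y₀` in the weak-star topology, but
far from it after composition with `S`, is found in the earlier iterate; a unit vector on which the
difference is large may be corrected by an element of a finite net of the ball, on which the
difference is small, so as to be almost annihilated by finitely many given functionals. -/
theorem exists_next_pair (S : X →L[𝕜] Y) {δ : ℝ} (hδ : 0 < δ) {ξ ζ : Ordinal.{u}} (hζ : ζ < ξ)
    {y₀ : WeakDual 𝕜 Y} (hy₀ : y₀ ∈ seminormIter (adjointSeminorm S) δ (weakBall 𝕜 Y) ξ)
    {F : Set Y} (hF : F.Finite) {ι : Type*} [Finite ι] (f : ι → StrongDual 𝕜 X) {τ : ℝ}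
    (hτ : 0 < τ) :
    ∃ y ∈ seminormIter (adjointSeminorm S) δ (weakBall 𝕜 Y) ζ, ∃ x : X, ‖x‖ ≤ 8 / δ ∧
      y (S x) - y₀ (S x) = 1 ∧ (∀ v ∈ F, ‖y v - y₀ v‖ ≤ τ) ∧ ∀ i, ‖f i x‖ ≤ τ := by
  -- The difference found below is larger than `δ / 4` at the corrected vector, so that normalizing
  -- this vector costs a factor `4 / δ`, which the tolerance of the net anticipates.
  obtain ⟨A, hAf, hA1, hA⟩ := exists_finite_approx_ball f (τ := τ * (δ / 4)) (by positivity)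
  have hfin : (F ∪ S '' A).Finite := hF.union (hAf.image S)
  have hopen : IsOpen {y : WeakDual 𝕜 Y | ∀ v ∈ F ∪ S '' A, ‖y v - y₀ v‖ < min τ (δ / 4)} := by
    rw [Set.ofPred_forall]
    simp only [Set.ofPred_forall]
    refine hfin.isOpen_biInter fun v _ => ?_
    exact isOpen_lt ((WeakDual.eval_continuous v).sub continuous_const).norm continuous_const
  obtain ⟨y, hy, hyU, hfar⟩ := exists_far_mem hy₀ hζ hopen (fun v _ => by
    rw [sub_self, norm_zero]; positivity)
  rw [adjointSeminorm_apply] at hfar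
  obtain ⟨x₁, hx₁, hbig⟩ := ContinuousLinearMap.exists_lt_apply_of_lt_opNorm _ hfar
  replace hbig : δ / 2 < ‖y (S x₁) - y₀ (S x₁)‖ := hbig
  obtain ⟨a, ha, hax⟩ := hA x₁ hx₁.le
  have hsmall : ‖y (S a) - y₀ (S a)‖ < δ / 4 :=
    (hyU (S a) (Or.inr ⟨a, ha, rfl⟩)).trans_le (min_le_right _ _)
  set r : 𝕜 := y (S (x₁ - a)) - y₀ (S (x₁ - a)) with hr
  have hrn : δ / 4 < ‖r‖ := by
    have h1 : r = (y (S x₁) - y₀ (S x₁)) - (y (S a) - y₀ (S a)) := by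
      rw [hr, map_sub, map_sub, map_sub]; ring
    have h2 := norm_sub_norm_le (y (S x₁) - y₀ (S x₁)) (y (S a) - y₀ (S a))
    rw [← h1] at h2
    linarith
  have hr0 : 0 < ‖r‖ := (by positivity : 0 < δ / 4).trans hrn
  have hri : ‖r‖⁻¹ ≤ 4 / δ := by
    rw [inv_le_comm₀ hr0 (by positivity), inv_div]
    exact hrn.le
  refine ⟨y, hy, r⁻¹ • (x₁ - a), ?_, ?_, fun v hv =>
    ((hyU v (Or.inl hv)).trans_le (min_le_left _ _)).le, fun i => ?_⟩
  · rw [norm_smul, norm_inv]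
    have h1 : ‖x₁ - a‖ ≤ 2 := (norm_sub_le _ _).trans (by linarith [hA1 a ha])
    calc _ ≤ 4 / δ * 2 := mul_le_mul hri h1 (norm_nonneg _) (by positivity)
      _ = 8 / δ := by ring
  · rw [map_smul, map_smul, map_smul, ← smul_sub, ← hr, smul_eq_mul,
      inv_mul_cancel₀ (norm_pos_iff.1 hr0)]
  · rw [map_smul, norm_smul, norm_inv]
    calc _ ≤ 4 / δ * (τ * (δ / 4)) := mul_le_mul hri (hax i).le (norm_nonneg _) (by positivity)
      _ = τ := by field_simp

variable {T : Type u} [PartialOrder T] [IsTree T] [IsWellFoundedTree T]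

/-- Admissibility of the pair `e`, consisting of a functional and a vector, at the node `t` of a
tree numbered by `c`, given the pairs `f` at the nodes with smaller numbers: the functional lies in
the iterate of order `g t`, its increment along the tree is small on the first terms of the
sequence `d` and on the earlier vectors, and the vector, of norm at most `8 / δ`, is almost
annihilated by the earlier increments while `S` sends it to a point where the increment is `1`. At
the root only the functional matters, and it is `0`. -/
def IsAdmissiblePair (S : X →L[𝕜] Y) (δ : ℝ) (g : T → Ordinal.{0}) (c : T → ℕ) (d : ℕ → Y) (t : T)
    (f : T → WeakDual 𝕜 Y × X) (e : WeakDual 𝕜 Y × X) : Prop :=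
  e.1 ∈ seminormIter (adjointSeminorm S) δ (weakBall 𝕜 Y) (g t) ∧
    (IsMin t → e.1 = 0) ∧ ∀ h : ¬ IsMin t,
      ‖e.2‖ ≤ 8 / δ ∧ e.1 (S e.2) - (f (treePred ⟨t, h⟩)).1 (S e.2) = 1 ∧
      (∀ k ≤ c t, ‖e.1 (d k) - (f (treePred ⟨t, h⟩)).1 (d k)‖ ≤ 1 / 4 * (1 / 2) ^ c t) ∧
      (∀ s, c s < c t → ‖e.1 (S (f s).2) - (f (treePred ⟨t, h⟩)).1 (S (f s).2)‖ ≤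
        1 / 4 * (1 / 2) ^ c t) ∧
      ∀ s : starTree T, c s < c t →
        ‖(f s).1 (S e.2) - (f (treePred s)).1 (S e.2)‖ ≤ 1 / 4 * (1 / 2) ^ c s

theorem exists_isAdmissiblePair {S : X →L[𝕜] Y} {δ : ℝ} (hδ : 0 < δ) {g : T → Ordinal.{0}}
    (hg : StrictAnti g)
    (h0 : ∀ t, (0 : WeakDual 𝕜 Y) ∈ seminormIter (adjointSeminorm S) δ (weakBall 𝕜 Y) (g t))
    {c : T → ℕ} (hc : StrictMono c) (hci : Function.Injective c) (d : ℕ → Y) (t : T)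
    {f : T → WeakDual 𝕜 Y × X} (hf : ∀ s, c s < c t → IsAdmissiblePair S δ g c d s f (f s)) :
    ∃ e, IsAdmissiblePair S δ g c d t f e := by
  by_cases ht : IsMin t
  · exact ⟨(0, 0), h0 t, fun _ => rfl, fun h => absurd ht h⟩
  have hlow : {s : T | c s < c t}.Finite := (Set.finite_lt_nat (c t)).preimage hci.injOn
  have : Finite {s : starTree T // c s < c t} :=
    Set.Finite.to_subtype (hlow.preimage Subtype.val_injective.injOn)
  have hpred := treePred_lt (⟨t, ht⟩ : starTree T)
  obtain ⟨y, hy, x, hx, hxy, hyF, hxf⟩ := exists_next_pair S hδ (hg hpred) (hf _ (hc hpred)).1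
    (((Set.finite_le_nat (c t)).image d).union (hlow.image fun s => S (f s).2))
    (fun s : {s : starTree T // c s < c t} =>
      (WeakDual.toStrongDual (f s.1).1 - WeakDual.toStrongDual (f (treePred s.1)).1).comp S)
    (τ := 1 / 4 * (1 / 2) ^ c t) (by positivity)
  refine ⟨(y, x), hy, fun h => absurd h ht, fun h => ⟨hx, hxy, fun k hk => ?_, fun s hs => ?_,
    fun s hs => ?_⟩⟩
  · exact hyF _ (Or.inl ⟨k, hk, rfl⟩)
  · exact hyF _ (Or.inr ⟨s, hs, rfl⟩)
  · refine (hxf ⟨s, hs⟩).trans ?_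
    gcongr 1 / 4 * ?_
    exact pow_le_pow_of_le_one (by norm_num) (by norm_num) hs.le

/-- If the rank of the tree, measured by a strictly decreasing function `g`, is such that `0` lies
in all the iterates of the dual ball of orders `g t`, then `sigmaOp` factors through `S`. The
factor `1 / 4` in the tolerances makes them add up to at most `1 / 2`. -/
theorem factorsThrough_of_zero_mem_seminormIter [IsRooted T] [CompleteSpace X] [Countable T]
    [TopologicalSpace.SeparableSpace Y] (S : X →L[𝕜] Y) {δ : ℝ} (hδ : 0 < δ)
    {g : T → Ordinal.{0}} (hg : StrictAnti g)
    (h0 : ∀ t, (0 : WeakDual 𝕜 Y) ∈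
      seminormIter (adjointSeminorm S) δ (weakBall 𝕜 Y) (g t)) :
    FactorsThrough (sigmaOp 𝕜 T) S := by
  obtain ⟨c, hc, hci⟩ := exists_strictMono_injective (T := T)
  obtain ⟨d, hd⟩ := TopologicalSpace.exists_dense_seq Y
  have hex : ∃ f : T → WeakDual 𝕜 Y × X, ∀ t, IsAdmissiblePair S δ g c d t f (f t) := by
    refine exists_forall_of_numbering c _ (fun t f f' e hff' he => ?_) fun t f =>
      exists_isAdmissiblePair hδ hg h0 hc hci d t
    refine ⟨he.1, he.2.1, fun h => ?_⟩
    have hpred := hff' _ (hc (treePred_lt ⟨t, h⟩))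
    obtain ⟨h1, h2, h3, h4, h5⟩ := he.2.2 h
    rw [hpred] at h2 h3 h4
    refine ⟨h1, h2, h3, fun s hs => ?_, fun s hs => ?_⟩
    · rw [← hff' s hs]
      exact h4 s hs
    · rw [← hff' s hs, ← hff' _ ((hc (treePred_lt s)).trans hs)]
      exact h5 s hs
  obtain ⟨f, hf⟩ := hex
  have hcinj : Function.Injective fun t : starTree T => c t := hci.comp Subtype.val_injective
  have hgeom : Summable fun t : starTree T => (1 / 4 * (1 / 2) ^ c t : ℝ) :=
    (summable_geometric_two.comp_injective hcinj).mul_left _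
  refine factorsThrough_of_almost_biorthogonal S (fun t => WeakDual.toStrongDual (f t).1)
    (fun t => mem_weakBall.1 (seminormIter_subset _ (hf t).1))
    (fun t ht => by rw [(hf t).2.1 ht, map_zero]) (D := Set.range d) hd ?_
    (fun t => (f t).2) (C := 8 / δ) (fun t => ((hf t).2.2 t.2).1)
    (fun t => ((hf t).2.2 t.2).2.1) (e := fun t => 1 / 4 * (1 / 2) ^ c t)
    (fun t => by positivity) hgeom ?_ ?_
  · rintro _ ⟨k, rfl⟩
    refine Summable.of_norm_bounded_eventually hgeom ?_
    have hfin : {t : starTree T | c t < k}.Finite :=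
      (Set.finite_lt_nat k).preimage hcinj.injOn
    filter_upwards [hfin.compl_mem_cofinite] with t ht
    rw [norm_norm]
    exact ((hf t).2.2 t.2).2.2.1 k (not_lt.1 ht)
  · rw [tsum_mul_left]
    have := tsum_comp_le_tsum_of_inj summable_geometric_two (fun _ => by positivity) hcinj
    rw [tsum_geometric_two] at this
    have h' : ∑' t : starTree T, (1 / 2 : ℝ) ^ c t ≤ 2 := this
    linarith
  · intro r t hrt
    rcases lt_or_gt_of_ne (hcinj.ne hrt) with h | h
    · exact ((hf t).2.2 t.2).2.2.2.2 r h
    · exact ((hf r).2.2 r.2).2.2.2.1 t h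

/-- The absolute convexity of the dual ball turns an iterate of order `ω ^ α` into iterates of order
`ω ^ α * n`, one of which exceeds the rank of the tree. -/
theorem factorsThrough_of_not_isSzlenk [IsRooted T] [CompleteSpace X] [Countable T]
    [TopologicalSpace.SeparableSpace Y] {α : Ordinal.{0}}
    (hρ : treeRank T < Ordinal.lift.{u} (ω ^ (α + 1))) {S : X →L[𝕜] Y}
    (hS : ¬ IsSzlenk (Ordinal.lift.{v} α) S) : FactorsThrough (sigmaOp 𝕜 T) S := by
  obtain ⟨ε, hε, hne⟩ := not_szlenkIndex_le_iff.1 hS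
  rw [← lift_omega0_opow, szlenkIter_lift] at hne
  have hrank : ∀ t : T, ∃ ξ : Ordinal.{0}, Ordinal.lift.{u} ξ = revRank t := fun t => by
    obtain ⟨ξ, -, h⟩ := Ordinal.lt_lift_iff.1 ((revRank_lt_treeRank t).trans hρ)
    exact ⟨ξ, h⟩
  choose g hg using hrank
  obtain ⟨β, hβ, hβT⟩ := Ordinal.lt_lift_iff.1 hρ
  rw [← Order.succ_eq_add_one] at hβ
  obtain ⟨n, hn⟩ := Ordinal.lt_omega0_opow_succ.1 hβ
  obtain ⟨δ, hδ, h0⟩ := exists_zero_mem_seminormIter_mul S hε hne n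
  refine factorsThrough_of_zero_mem_seminormIter S hδ (g := g) (fun s t hst => ?_) fun t =>
    seminormIter_antitone _ _ _ ?_ h0
  · rw [← Ordinal.lift_lt.{u, 0}, hg, hg]
    exact WellFoundedGT.rank_strictAnti hst
  · refine (?_ : g t < β).le.trans hn.le
    rw [← Ordinal.lift_lt.{u, 0}, hg, hβT]
    exact revRank_lt_treeRank t

end Construction

/-! ### The coarse wedge topology of a countable tree -/

section Topology

variable {T : Type u} [PartialOrder T]

theorem secondCountableTopology_coarseWedge [Countable T] :
    SecondCountableTopology (CoarseWedge T) := by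
  have : Countable (CoarseWedge T) := ‹Countable T›
  refine TopologicalSpace.SecondCountableTopology.mk' ((Set.Countable.union
    (Set.countable_range fun t : CoarseWedge T => Set.Ici t)
    (Set.countable_range fun t : CoarseWedge T => (Set.Ici t)ᶜ)).mono ?_)
  rintro U ⟨t, -, rfl | rfl⟩
  · exact Or.inl ⟨t, rfl⟩
  · exact Or.inr ⟨t, rfl⟩

variable [IsTree T]

/-- Distinct immediate successors of a node converge to this node. -/
theorem tendsto_of_mem_immSucc {t : T} {ψ : ℕ → T} (hψ : Function.Injective ψ)
    (hs : ∀ n, ψ n ∈ immSucc t) :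
    Filter.Tendsto (fun n => CoarseWedge.of (ψ n)) Filter.atTop (nhds (CoarseWedge.of t)) := by
  rw [TopologicalSpace.nhds_generateFrom]
  simp only [Filter.tendsto_iInf, Filter.tendsto_principal]
  rintro U ⟨htU, r, -, rfl | rfl⟩
  · exact Filter.Eventually.of_forall fun n => le_trans (α := T) htU (hs n).prop.le
  · have hsub : {n | CoarseWedge.of (ψ n) ∉ (Set.Ici r)ᶜ} ⊆ ψ ⁻¹' {CoarseWedge.of.symm r} := by
      intro n hn
      have hrn : CoarseWedge.of.symm r ≤ ψ n := not_not.1 hn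
      have hrt : ¬ CoarseWedge.of.symm r ≤ t := htU
      have htr : t ≤ CoarseWedge.of.symm r :=
        (le_total_of_le (hs n).prop.le hrn).resolve_right hrt
      have htr' : t < CoarseWedge.of.symm r := lt_of_le_of_ne htr fun h => hrt h.ge
      exact le_antisymm ((hs n).le_of_le htr' hrn) hrn
    have hfin := ((Set.finite_singleton (CoarseWedge.of.symm r)).preimage hψ.injOn).subset hsub
    have := hfin.compl_mem_cofinite
    rw [Nat.cofinite_eq_atTop] at this
    filter_upwards [this] with n hn
    exact not_not.1 hn

variable [IsWellFoundedTree T]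

theorem t2Space_coarseWedge : T2Space (CoarseWedge T) := by
  have key : ∀ s t : CoarseWedge T, ¬ s ≤ t → ∃ U V : Set (CoarseWedge T),
      IsOpen U ∧ IsOpen V ∧ s ∈ U ∧ t ∈ V ∧ Disjoint U V := fun s t h =>
    ⟨Set.Ici s, (Set.Ici s)ᶜ, (isClopen_Ici s).isOpen, (isClopen_Ici s).compl.isOpen,
      le_refl s, h, disjoint_compl_right⟩
  refine ⟨fun s t hst => ?_⟩
  by_cases h : s ≤ t
  · obtain ⟨U, V, hU, hV, hs, ht, hd⟩ := key t s fun h' => hst (le_antisymm h h')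
    exact ⟨V, U, hV, hU, ht, hs, hd.symm⟩
  · exact key s t h

theorem separableSpace_C0 (𝕜 : Type w) [RCLike 𝕜] [IsRooted T] [Countable T] :
    TopologicalSpace.SeparableSpace (C0 𝕜 T) := by
  have := secondCountableTopology_coarseWedge (T := T)
  have := t2Space_coarseWedge (T := T)
  have : SecondCountableTopology (C0 𝕜 T) :=
    TopologicalSpace.Subtype.secondCountableTopology (C0 𝕜 T : Set C(CoarseWedge T, 𝕜))
  infer_instance

theorem exists_mem_immSucc_le {s t : T} (h : t < s) : ∃ r ∈ immSucc t, r ≤ s := by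
  obtain ⟨r, hr⟩ := ((finite_Iic s).subset
    (fun r hr => hr.2 : {r | t < r ∧ r ≤ s} ⊆ _)).exists_minimal ⟨s, h, le_rfl⟩
  exact ⟨r, ⟨hr.prop.1, fun q hq hqr => hr.le_of_le ⟨hq, hqr.trans hr.prop.2⟩ hqr⟩, hr.prop.2⟩

end Topology

/-! ### The Szlenk index of the operator of a blossomed tree -/

section Blossomed

variable {𝕜 : Type w} [RCLike 𝕜] {T : Type u} [PartialOrder T] [IsTree T] [IsRooted T]
  [IsWellFoundedTree T]

theorem evalC0_comp_sigmaOp_mem_adjointBall (t : T) :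
    (evalC0 t).comp (sigmaOp 𝕜 T) ∈ adjointBall (sigmaOp 𝕜 T) := by
  refine ⟨evalC0 t, ?_, rfl⟩
  rw [mem_closedBall_zero_iff]
  refine ContinuousLinearMap.opNorm_le_bound _ zero_le_one fun f => ?_
  rw [one_mul]
  exact ContinuousMap.norm_coe_le_norm (f : C(CoarseWedge T, 𝕜)) _

theorem one_le_norm_evalC0_sub {s t : T} (h : t < s) :
    1 ≤ ‖(evalC0 s).comp (sigmaOp 𝕜 T) - (evalC0 t).comp (sigmaOp 𝕜 T)‖ := by
  classical
  let r : starTree T := ⟨s, fun hs => h.not_ge (hs h.le)⟩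
  have h1 : ((evalC0 s).comp (sigmaOp 𝕜 T) - (evalC0 t).comp (sigmaOp 𝕜 T))
      (lp.single 1 r 1) = 1 := by
    have hr : sigmaOp 𝕜 T (lp.single 1 r 1) = wedgeIndicator 𝕜 r := by
      convert sigmaOp_single 𝕜 T r
    change evalC0 s (sigmaOp 𝕜 T (lp.single 1 r 1)) - evalC0 t (sigmaOp 𝕜 T (lp.single 1 r 1)) = 1
    rw [hr, evalC0_wedgeIndicator, evalC0_wedgeIndicator, if_pos le_rfl, if_neg h.not_ge, sub_zero]
  have h2 := ((evalC0 s).comp (sigmaOp 𝕜 T) - (evalC0 t).comp (sigmaOp 𝕜 T)).le_opNorm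
    (lp.single 1 r 1)
  rw [h1, lp.norm_single (by simp)] at h2
  simpa using h2

/-- In a blossomed tree, the evaluation at a node `t` survives as many derivations as the rank of
`t` allows: infinitely many immediate successors of `t` have rank at least any given ordinal below
the rank of `t`, their evaluations converge weak-star to that at `t`, and they stay at distance at
least `1` from it. -/
theorem evalC0_comp_sigmaOp_mem_szlenkIter (hT : IsBlossomed T) {ξ : Ordinal.{v}} {t : T}
    (h : Ordinal.lift.{u} ξ ≤ Ordinal.lift.{v} (revRank t)) :
    (evalC0 t).comp (sigmaOp 𝕜 T) ∈ szlenkIter (1 / 2) (adjointBall (sigmaOp 𝕜 T)) ξ := by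
  induction ξ using WellFoundedLT.induction generalizing t with
  | ind ξ ih =>
    refine mem_szlenkIter_iff.2 ⟨evalC0_comp_sigmaOp_mem_adjointBall t, fun ζ hζ =>
      ⟨ih ζ hζ ((Ordinal.lift_le.2 hζ.le).trans h), fun U hU htU => ?_⟩⟩
    obtain ⟨η, hη, hζη⟩ := Ordinal.lt_lift_iff.1 ((Ordinal.lift_lt.{u}.2 hζ).trans_le h)
    obtain ⟨s, hts, hs⟩ := add_one_le_revRank_iff.1 (Order.add_one_le_iff.2 hη)
    obtain ⟨ψ, hψ⟩ := hT.2.2.2.2 t fun hmax => hts.not_ge (hmax hts.le)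
    obtain ⟨r, hr, hrs⟩ := exists_mem_immSucc_le hts
    set m := ψ.symm ⟨r, hr⟩ with hm
    have hrank : ∀ n ≥ m, Ordinal.lift.{u} ζ ≤ Ordinal.lift.{v} (revRank (ψ n : T)) := by
      intro n hn
      rw [← hζη, Ordinal.lift_le]
      have h1 := hψ m n hn
      rw [nodeRank_eq_revRank, nodeRank_eq_revRank, hm, Equiv.apply_symm_apply] at h1
      exact (hs.trans (WellFoundedGT.rank_strictAnti.antitone hrs)).trans h1
    have hconv : Filter.Tendsto
        (fun n => StrongDual.toWeakDual ((evalC0 (ψ n : T)).comp (sigmaOp 𝕜 T))) Filter.atTop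
        (nhds (StrongDual.toWeakDual ((evalC0 t).comp (sigmaOp 𝕜 T)))) := by
      rw [tendsto_iff_forall_eval_tendsto_topDualPairing]
      intro x
      exact ((sigmaOp 𝕜 T x : C(CoarseWedge T, 𝕜)).continuous.tendsto _).comp
        (tendsto_of_mem_immSucc (Subtype.val_injective.comp ψ.injective) fun n => (ψ n).2)
    obtain ⟨n, hnU, hn⟩ := ((hconv.eventually (hU.mem_nhds htU)).and
      (Filter.eventually_ge_atTop m)).exists
    have hfar := one_le_norm_evalC0_sub (𝕜 := 𝕜) (ψ n).2.prop
    have hxn : (evalC0 (ψ n : T)).comp (sigmaOp 𝕜 T) ∈ StrongDual.toWeakDual ⁻¹' U ∩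
        szlenkIter (1 / 2) (adjointBall (sigmaOp 𝕜 T)) ζ := ⟨hnU, ih ζ hζ (hrank n hn)⟩
    have hx : (evalC0 t).comp (sigmaOp 𝕜 T) ∈ StrongDual.toWeakDual ⁻¹' U ∩
        szlenkIter (1 / 2) (adjointBall (sigmaOp 𝕜 T)) ζ :=
      ⟨htU, ih ζ hζ ((Ordinal.lift_le.2 hζ.le).trans h)⟩
    have hxn : (evalC0 (ψ n : T)).comp (sigmaOp 𝕜 T) ∈ StrongDual.toWeakDual ⁻¹' U ∩
        szlenkIter (1 / 2) (adjointBall (sigmaOp 𝕜 T)) ζ := ⟨hnU, ih ζ hζ (hrank n hn)⟩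
    have hx : (evalC0 t).comp (sigmaOp 𝕜 T) ∈ StrongDual.toWeakDual ⁻¹' U ∩
        szlenkIter (1 / 2) (adjointBall (sigmaOp 𝕜 T)) ζ :=
      ⟨htU, ih ζ hζ ((Ordinal.lift_le.2 hζ.le).trans h)⟩
    have hxn : (evalC0 (ψ n : T)).comp (sigmaOp 𝕜 T) ∈ StrongDual.toWeakDual ⁻¹' U ∩
        szlenkIter (1 / 2) (adjointBall (sigmaOp 𝕜 T)) ζ := ⟨hnU, ih ζ hζ (hrank n hn)⟩
    have hx : (evalC0 t).comp (sigmaOp 𝕜 T) ∈ StrongDual.toWeakDual ⁻¹' U ∩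
        szlenkIter (1 / 2) (adjointBall (sigmaOp 𝕜 T)) ζ :=
      ⟨htU, ih ζ hζ ((Ordinal.lift_le.2 hζ.le).trans h)⟩
    refine lt_of_lt_of_le ?_ (Metric.edist_le_ediam_of_mem hxn hx)
    rw [edist_dist, dist_eq_norm]
    exact (ENNReal.ofReal_lt_ofReal_iff (by linarith)).2 (by linarith)

theorem not_isSzlenk_sigmaOp [Infinite T] (hT : IsBlossomed T) {α : Ordinal.{0}}
    (hρ : Ordinal.lift.{u} (ω ^ α) ≤ treeRank T) :
    ¬ IsSzlenk (Ordinal.lift.{max u w} α) (sigmaOp 𝕜 T) := by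
  obtain ⟨t₀⟩ : Nonempty T := inferInstance
  obtain ⟨m, hm, -⟩ := exists_isMin_le t₀
  have hrank : Ordinal.lift.{u} (ω ^ α) ≤ revRank m := by
    have h1 := hρ.trans (treeRank_le_revRank_add_one hm)
    rcases eq_or_ne α 0 with rfl | hα
    · obtain ⟨s, hs⟩ := exists_ne m
      rw [Ordinal.opow_zero, Ordinal.lift_one, ← zero_add 1]
      exact add_one_le_revRank_iff.2 ⟨s, lt_of_le_of_ne (le_of_isMin hm s) hs.symm, bot_le⟩
    · by_contra! hlt
      have hlim : Order.IsSuccLimit (Ordinal.lift.{u} (ω ^ α)) :=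
        Ordinal.isSuccLimit_lift.2 (Ordinal.isSuccLimit_opow_left Ordinal.isSuccLimit_omega0 hα)
      exact (hlim.add_one_lt hlt).not_ge h1
  refine not_szlenkIndex_le_iff.2 ⟨1 / 2, by norm_num, (evalC0 m).comp (sigmaOp 𝕜 T), ?_⟩
  rw [← lift_omega0_opow, szlenkIter_lift]
  refine evalC0_comp_sigmaOp_mem_szlenkIter hT ?_
  rwa [Ordinal.lift_uzero]

end Blossomed

end SzlenkTree

end

theorem mainTheorem5 {𝕜 : Type w} [RCLike 𝕜]
    (T : Type u) [PartialOrder T] [SzlenkTree.IsTree T] [SzlenkTree.IsRooted T]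
    [SzlenkTree.IsWellFoundedTree T] [Countable T] [Infinite T]
    (α : Ordinal.{0}) (hα : α < ω₁)
    (hρ : SzlenkTree.treeRank T < Ordinal.lift.{u} (ω ^ (α + 1))) :
    (∀ (X : Type v) [NormedAddCommGroup X] [NormedSpace 𝕜 X] [CompleteSpace X]
        (Y : Type v') [NormedAddCommGroup Y] [NormedSpace 𝕜 Y] [CompleteSpace Y]
        [TopologicalSpace.SeparableSpace Y] (S : X →L[𝕜] Y),
        ¬ SzlenkTree.IsSzlenk (Ordinal.lift.{v} α) S →
          SzlenkTree.FactorsThrough (SzlenkTree.sigmaOp 𝕜 T) S) ∧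
      (SzlenkTree.IsBlossomed T → Ordinal.lift.{u} (ω ^ α) ≤ SzlenkTree.treeRank T →
        SzlenkTree.IsUniversalNonSzlenkSep.{v, v', w} α (SzlenkTree.sigmaOp 𝕜 T)) := by
  refine ⟨fun X _ _ _ Y _ _ _ _ S hS => SzlenkTree.factorsThrough_of_not_isSzlenk hρ hS,
    fun hT hρ' => ⟨⟨SzlenkTree.not_isSzlenk_sigmaOp hT hρ', SzlenkTree.separableSpace_C0 𝕜⟩,
      fun X _ _ _ Y _ _ _ S hS => ?_⟩⟩
  have := hS.2
  exact SzlenkTree.factorsThrough_of_not_isSzlenk hρ hS.1
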